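/- Let $k\in\mathbb{C}$ with $\operatorname{Re}k<\tfrac12$ and let $m\in\mathbb{R}$. Let $W_{k,m}$ be Whittaker's function on the sector $|\arg z|<\pi$, and for real $z<1$ let $$F(z)={}_2F_1\left(\tfrac12+m-k,\ \tfrac12+m-\bar k;\ 1-2\operatorname{Re}k;\ z\right),$$ where ${}_2F_1$ denotes the principal branch (the analytic continuation of the Gauss series from $(-1,1)$ to $(-\infty,1)$). For $x\in\mathbb{C}\setminus\{0\}$ with $|\arg x|<\pi$ put $$f(t)=t^{-1}e^{t\operatorname{Re}x}\,|W_{k,m}(tx)|^2,\qquad t>0.$$ (i) If $F$ has no zero in $(-\infty,0)$, then for every $x\neq0$ with $|\arg x|<\pi$ the function $f$ is strictly completely monotone on $(0,\infty)$, that is, $f$ is smooth on $(0,\infty)$ and $(-1)^nf^{(n)}(t)>0$ for all $t>0$ and all $n=0,1,2,\dots$ (ii) If $F$ has a zero in $(-\infty,0)$, then it has a largest negative zero $p$, and with $\theta\in(\pi/2,\pi)$ the angle determined by $\tan\theta=-(-p)^{-1/2}$, the function $f$ is strictly completely monotone on $(0,\infty)$ for every $x\neq0$ with $|\arg x|\le\theta$.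 -/

import Mathlib

/-- `F` is the analytic continuation to the real interval `(-∞, 1)` of the Gauss series
`∑ (a)ₙ (b)ₙ / ((c)ₙ n!) zⁿ` (convergent for `|z| < 1`). By the identity theorem there is at most one
such function on `(-∞, 1)`. It is the restriction of the principal branch of `₂F₁(a, b; c; ·)` on
`ℂ \ [1, ∞)`. -/
def IsGaussContinuation (a b c : ℂ) (F : ℝ → ℂ) : Prop :=
  AnalyticOnNhd ℝ F (Set.Iio 1) ∧
    ∀ z : ℝ, |z| < 1 → F z = ordinaryHypergeometric a b c (z : ℂ)

open Classical in
/-- The principal branch of the hypergeometric function `₂F₁(a, b; c; z)` at a real argument `z < 1`,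
obtained from the Gauss series by analytic continuation along the real axis. The continuation exists
whenever `c` is not a non-positive integer (singular points of the hypergeometric equation: `0, 1, ∞`),
so that the value in the `else` branch plays no role. -/
noncomputable def hyp2F1 (a b c : ℂ) (z : ℝ) : ℂ :=
  if h : ∃ F : ℝ → ℂ, IsGaussContinuation a b c F then h.choose z else 0

/-- Whittaker's function `W_{k,m}(z)` for real `m`, `Re k < 1/2 + |m|` and `z ≠ 0`, `|arg z| < π`,
by Whittaker's integral
`W_{k,m}(z) = e^{-z/2} z^k / Γ(1/2 + m - k) * ∫₀^∞ s^{m-k-1/2} (1 + s/z)^{m+k-1/2} e^{-s} ds`,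
which is the definition when `Re (1/2 + m - k) > 0`, and by the symmetry `W_{k,m} = W_{k,-m}`, which
allows `m` to be replaced by `|m|`. All powers are principal values; `1 + s/z` does not meet
the cut `(-∞, 0]`. -/
noncomputable def whittakerW (k : ℂ) (m : ℝ) (z : ℂ) : ℂ :=
  Complex.exp (-z / 2) * z ^ k / Complex.Gamma (1 / 2 + (|m| : ℝ) - k) *
    ∫ s in Set.Ioi (0 : ℝ), (s : ℂ) ^ (((|m| : ℝ) : ℂ) - k - 1 / 2) *
      (1 + (s : ℂ) / z) ^ (((|m| : ℝ) : ℂ) + k - 1 / 2) * Complex.exp (-(s : ℂ))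

/-- The negative zeros of `F(z) = ₂F₁(1/2 + m - k, 1/2 + m - k̄; 1 - 2 Re k; z)`. -/
def negativeZeros (k : ℂ) (m : ℝ) : Set ℝ :=
  {z : ℝ | z < 0 ∧
    hyp2F1 (1 / 2 + (m : ℂ) - k) (1 / 2 + (m : ℂ) - (starRingEnd ℂ) k) (1 - 2 * (k.re : ℂ)) z = 0}

/-- `f` is strictly completely monotone on `(0, ∞)`: it is smooth there and
`(-1)ⁿ f⁽ⁿ⁾(t) > 0` for all `t > 0` and all `n = 0, 1, 2, …`. -/
def StrictlyCompletelyMonotone (f : ℝ → ℝ) : Prop :=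
  ContDiffOn ℝ (⊤ : ℕ∞) f (Set.Ioi 0) ∧
    ∀ n : ℕ, ∀ t : ℝ, 0 < t → 0 < (-1 : ℝ) ^ n * iteratedDeriv n f t

/-- The function `f(t) = t⁻¹ e^{t Re x} |W_{k,m}(t x)|²`. -/
noncomputable def whittakerModulus (k : ℂ) (m : ℝ) (x : ℂ) (t : ℝ) : ℝ :=
  t⁻¹ * Real.exp (t * x.re) * ‖whittakerW k m ((t : ℂ) * x)‖ ^ 2

/-! Put α = 1/2 - k, μ = |m| and c = 2 Re α = 1 - 2 Re k > 0. Whittaker's integral reads W(z) =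
e^{-z/2} z^k V(α, μ, 1/z), where V is a normalised Laplace-type integral (`whittV`). In f the
exponentials and the powers of t cancel, and f becomes a positive constant times the Laplace
transform in t of a density ρ that depends on x (`whittakerModulus_eq_laplace`). A Laplace transform
of a nonnegative density that is positive near 0 is strictly completely monotone, so everything
rests on the sign of ρ.

The density comes from a product formula for V(α, μ, w) V(ᾱ, μ, w̄) (`whittV_mul_conj`). Since V is
even in μ (`whittV_symm`), the first factor may be taken at -μ. The product of the two Laplace
integrals is then the integral of a convolution, and this convolution has four branch points whose
exponents allow a Möbius map to turn it into Euler's integral for ₂F₁ (`moebius_euler_integral`).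
This works for |Re μ| < Re α; holomorphy in μ extends the formula to Re (α + μ) > 0, which is needed
because |m| may exceed Re α.

Pfaff's transformation then makes the two upper parameters conjugate: ρ(v) is a positive weight
times H(1 - |1 + v/x|⁻²) with H = ₂F₁(α + μ, ᾱ + μ; c; ·) (`productDensity_eq`). H is real with H(0)
= 1, is positive on [0, 1) because its coefficients are nonnegative, and stays positive to the left
of 0 until its first zero. Its negative zeros are those of F, also for m < 0, by Euler's
transformation (`negativeZeros_eq`). Without such zeros ρ is positive for every x. Otherwise, the
bound on arg x is what keeps 1 - |1 + v/x|⁻² at or above p for all v > 0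
(`neg_le_one_sub_inv_norm_sq`). -/

/-! ### The Gauss series: coefficient bounds and holomorphy -/

/-- The coefficients `(a)ₙ (b)ₙ / ((c)ₙ n!)` of the Gauss series. -/
noncomputable def hypCoeff (a b : ℂ) (c : ℝ) (n : ℕ) : ℂ :=
  ∏ j ∈ Finset.range n, (a + j) * (b + j) / ((c + j) * (1 + j))

/-- The sum of the Gauss series. -/
noncomputable def hypSum (a b : ℂ) (c : ℝ) (z : ℂ) : ℂ :=
  ∑' n : ℕ, hypCoeff a b c n * z ^ n

lemma ascPochhammer_eval_eq_prod (a : ℂ) (n : ℕ) :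
    (ascPochhammer ℂ n).eval a = ∏ j ∈ Finset.range n, (a + j) := by
  induction n with
  | zero => simp
  | succ n ih => rw [ascPochhammer_succ_eval, ih, Finset.prod_range_succ]

lemma hypCoeff_eq (a b : ℂ) (c : ℝ) (n : ℕ) :
    hypCoeff a b c n = ((n.factorial : ℂ)⁻¹ * (ascPochhammer ℂ n).eval a *
      (ascPochhammer ℂ n).eval b * ((ascPochhammer ℂ n).eval (c : ℂ))⁻¹) := by
  have h : (n.factorial : ℂ) = ∏ j ∈ Finset.range n, (1 + (j : ℂ)) := by
    rw [← ascPochhammer_eval_eq_prod, ascPochhammer_eval_one]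
  rw [h]
  simp only [ascPochhammer_eval_eq_prod, hypCoeff, Finset.prod_inv_distrib,
    Finset.prod_mul_distrib, div_eq_mul_inv, mul_inv]
  ring

lemma ordinaryHypergeometric_eq_hypSum (a b : ℂ) (c : ℝ) (z : ℂ) :
    ordinaryHypergeometric a b (c : ℂ) z = hypSum a b c z := by
  rw [ordinaryHypergeometric_eq_tsum]
  simp only [hypSum, hypCoeff_eq, smul_eq_mul]

lemma hypCoeff_symm (a b : ℂ) (c : ℝ) : hypCoeff a b c = hypCoeff b a c := by
  funext n
  simp only [hypCoeff, mul_comm (a + _)]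

lemma hypSum_symm (a b : ℂ) (c : ℝ) : hypSum a b c = hypSum b a c := by
  funext z
  simp only [hypSum, hypCoeff_symm a b]

lemma hypSum_zero (a b : ℂ) (c : ℝ) : hypSum a b c 0 = 1 := by
  rw [hypSum, tsum_eq_single 0]
  · simp [hypCoeff]
  · intro n hn; simp [hn]

/-- The product form allows a factor-by-factor comparison with the Gauss coefficients. -/
lemma choose_add_eq_prod (D n : ℕ) :
    ((n + D).choose D : ℝ) = ∏ j ∈ Finset.range n, (((D : ℝ) + 1 + j) / (1 + j)) := by
  induction n with
  | zero => simp
  | succ n ih =>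
    rw [Finset.prod_range_succ, ← ih]
    have h := Nat.add_one_mul_choose_eq (n + D) n
    have h1 : (n + D).choose n = (n + D).choose D := by
      rw [Nat.choose_symm_add]
    have h2 : (n + D + 1).choose (n + 1) = (n + 1 + D).choose D := by
      rw [show n + D + 1 = n + 1 + D by omega, Nat.choose_symm_add]
    rw [h1, h2] at h
    have h' : ((n : ℝ) + D + 1) * ((n + D).choose D) = ((n + 1 + D).choose D) * (n + 1) := by
      exact_mod_cast h
    have : (1 + (n : ℝ)) ≠ 0 := by positivity
    field_simp
    linarith

/-- Each factor is controlled by (A + j)(B + j) ≤ (D + 1 + j)(c + j), for which the two conditions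
on `D` suffice. The majorant depends only on bounds for the parameters, so it also serves for
holomorphy in them. -/
lemma norm_hypCoeff_le {a b : ℂ} {c A B : ℝ} (hc : 0 < c) {D : ℕ} (hA : ‖a‖ ≤ A) (hB : ‖b‖ ≤ B)
    (h1 : A * B ≤ (D + 1) * c) (h2 : A + B ≤ D) (n : ℕ) :
    ‖hypCoeff a b c n‖ ≤ ((n + D).choose D : ℝ) := by
  rw [choose_add_eq_prod, hypCoeff, norm_prod]
  refine Finset.prod_le_prod (fun _ _ => norm_nonneg _) fun j _ => ?_
  have hA0 : 0 ≤ A := (norm_nonneg _).trans hA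
  have hj : (0 : ℝ) ≤ j := Nat.cast_nonneg j
  have ha : ‖a + j‖ ≤ A + j := (norm_add_le _ _).trans (by simpa using hA)
  have hb : ‖b + j‖ ≤ B + j := (norm_add_le _ _).trans (by simpa using hB)
  have e1 : ‖(c : ℂ) + j‖ = c + j := by
    rw [← Complex.ofReal_natCast, ← Complex.ofReal_add, Complex.norm_of_nonneg (by positivity)]
  have e2 : ‖(1 : ℂ) + j‖ = 1 + j := by
    rw [← Complex.ofReal_natCast, ← Complex.ofReal_one, ← Complex.ofReal_add,
      Complex.norm_of_nonneg (by positivity)]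
  rw [norm_div, norm_mul, norm_mul, e1, e2, div_le_div_iff₀ (by positivity) (by positivity)]
  have : ‖a + j‖ * ‖b + j‖ ≤ (A + j) * (B + j) :=
    mul_le_mul ha hb (norm_nonneg _) (by positivity)
  have h3 : (A + j) * (B + j) ≤ (D + 1 + j) * (c + j) := by nlinarith [mul_nonneg hc.le hj]
  calc ‖a + j‖ * ‖b + j‖ * (1 + j) ≤ ((D + 1 + j) * (c + j)) * (1 + j) := by
        exact mul_le_mul_of_nonneg_right (this.trans h3) (by positivity)
    _ = _ := by ring

/-- An exponent `D` for the bound of the Gauss coefficients exists for bounded parameters. -/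
lemma exists_hypCoeff_exponent {c : ℝ} (hc : 0 < c) (A B : ℝ) :
    ∃ D : ℕ, A * B ≤ (D + 1) * c ∧ A + B ≤ D := by
  obtain ⟨D, hD⟩ := exists_nat_ge (max (A * B / c) (A + B))
  refine ⟨D, ?_, (le_max_right _ _).trans hD⟩
  have := (le_max_left _ _).trans hD
  rw [div_le_iff₀ hc] at this
  linarith

lemma norm_hypTerm_le {a b : ℂ} {c A B : ℝ} (hc : 0 < c) {D : ℕ} (hA : ‖a‖ ≤ A) (hB : ‖b‖ ≤ B)
    (h1 : A * B ≤ (D + 1) * c) (h2 : A + B ≤ D) (n : ℕ) {z : ℂ} {r : ℝ} (hz : ‖z‖ ≤ r) :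
    ‖hypCoeff a b c n * z ^ n‖ ≤ ((n + D).choose D : ℝ) * r ^ n := by
  rw [norm_mul, norm_pow]
  exact mul_le_mul (norm_hypCoeff_le hc hA hB h1 h2 n) (pow_le_pow_left₀ (norm_nonneg _) hz n)
    (by positivity) (by positivity)

lemma summable_choose_mul_pow (D : ℕ) {r : ℝ} (h0 : 0 ≤ r) (h1 : r < 1) :
    Summable fun n : ℕ => ((n + D).choose D : ℝ) * r ^ n :=
  summable_choose_mul_geometric_of_norm_lt_one D (by rwa [Real.norm_of_nonneg h0])

lemma summable_norm_hyp (a b : ℂ) {c : ℝ} (hc : 0 < c) {z : ℂ} (hz : ‖z‖ < 1) :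
    Summable fun n : ℕ => ‖hypCoeff a b c n * z ^ n‖ := by
  obtain ⟨D, h1, h2⟩ := exists_hypCoeff_exponent hc ‖a‖ ‖b‖
  exact Summable.of_nonneg_of_le (fun _ => norm_nonneg _)
    (fun n => norm_hypTerm_le hc le_rfl le_rfl h1 h2 n le_rfl)
    (summable_choose_mul_pow D (norm_nonneg z) hz)

lemma hasSum_hypSum (a b : ℂ) {c : ℝ} (hc : 0 < c) {z : ℂ} (hz : ‖z‖ < 1) :
    HasSum (fun n : ℕ => hypCoeff a b c n * z ^ n) (hypSum a b c z) :=
  (summable_norm_hyp a b hc hz).of_norm.hasSum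

lemma norm_hypSum_le {a b : ℂ} {c A B : ℝ} (hc : 0 < c) {D : ℕ} (hA : ‖a‖ ≤ A) (hB : ‖b‖ ≤ B)
    (h1 : A * B ≤ (D + 1) * c) (h2 : A + B ≤ D) {z : ℂ} (hz : ‖z‖ < 1) :
    ‖hypSum a b c z‖ ≤ ((1 - ‖z‖)⁻¹) ^ (D + 1) := by
  have hs := hasSum_choose_mul_geometric_of_norm_lt_one (𝕜 := ℝ) D (r := ‖z‖) (by simpa using hz)
  have : ((1 - ‖z‖)⁻¹) ^ (D + 1) = 1 / (1 - ‖z‖) ^ (D + 1) := by simp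
  rw [this]
  exact tsum_of_norm_bounded hs fun n => norm_hypTerm_le hc hA hB h1 h2 n le_rfl

lemma differentiableOn_hypSum (a b : ℂ) {c : ℝ} (hc : 0 < c) :
    DifferentiableOn ℂ (hypSum a b c) (Metric.ball 0 1) := by
  intro z hz
  rw [mem_ball_zero_iff] at hz
  obtain ⟨r, hr1, hr2⟩ := exists_between hz
  obtain ⟨D, h1, h2⟩ := exists_hypCoeff_exponent hc ‖a‖ ‖b‖
  have := Complex.differentiableOn_tsum_of_summable_norm (U := Metric.ball (0 : ℂ) r)
    (F := fun n z => hypCoeff a b c n * z ^ n)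
    (summable_choose_mul_pow D ((norm_nonneg z).trans hr1.le) hr2)
    (fun n => by fun_prop) Metric.isOpen_ball
    (fun n w hw => norm_hypTerm_le hc le_rfl le_rfl h1 h2 n (mem_ball_zero_iff.mp hw).le)
  exact ((this.differentiableAt (Metric.isOpen_ball.mem_nhds (by simpa using hr1)))).differentiableWithinAt

/-- The Gauss sum is holomorphic in its parameters. -/
lemma differentiable_hypSum_param {p q : ℂ → ℂ} (hp : Differentiable ℂ p) (hq : Differentiable ℂ q)
    {c : ℝ} (hc : 0 < c) {z : ℂ} (hz : ‖z‖ < 1) :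
    Differentiable ℂ fun μ => hypSum (p μ) (q μ) c z := by
  intro μ₀
  obtain ⟨D, h1, h2⟩ := exists_hypCoeff_exponent hc (‖p μ₀‖ + 1) (‖q μ₀‖ + 1)
  have hn : ∀ {f : ℂ → ℂ}, Differentiable ℂ f → {μ | ‖f μ‖ < ‖f μ₀‖ + 1} ∈ nhds μ₀ := fun hf =>
    (isOpen_lt hf.continuous.norm continuous_const).mem_nhds (by simp)
  obtain ⟨U, hU, hUo, hμ⟩ := mem_nhds_iff.mp (Filter.inter_mem (hn hp) (hn hq))
  have := Complex.differentiableOn_tsum_of_summable_norm (U := U)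
    (F := fun n μ => hypCoeff (p μ) (q μ) c n * z ^ n)
    (summable_choose_mul_pow D (norm_nonneg z) hz)
    (fun n => by
      apply Differentiable.differentiableOn
      unfold hypCoeff
      refine Differentiable.mul ?_ (by fun_prop)
      refine Differentiable.fun_finsetProd fun j _ => ?_
      fun_prop) hUo
    (fun n w hw => norm_hypTerm_le hc (hU hw).1.le (hU hw).2.le h1 h2 n le_rfl)
  exact this.differentiableAt (hUo.mem_nhds hμ)

/-! ### Euler's integral and Pfaff's transformation inside the disc -/

/-- The binomial series of `(1 - z) ^ (-a)`. -/
lemma hasSum_one_sub_cpow (a : ℂ) {z : ℂ} (hz : ‖z‖ < 1) :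
    HasSum (fun n : ℕ => (∏ j ∈ Finset.range n, (a + j) / (1 + j)) * z ^ n) ((1 - z) ^ (-a)) := by
  have h := (Complex.one_add_cpow_hasFPowerSeriesOnBall_zero (a := -a)).hasSum (y := -z)
    (by rw [← ENNReal.ofReal_one, Metric.eball_ofReal]; simpa using hz)
  rw [binomialSeries_eq_ordinaryHypergeometricSeries (b := 1)
    (fun k => by intro h; have := congrArg Complex.re h; simp at this; linarith [(Nat.cast_nonneg k : (0:ℝ) ≤ k)])] at h
  have e : ∀ n : ℕ, (((ordinaryHypergeometricSeries ℂ (- -a) (1:ℂ) 1).compContinuousLinearMap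
      (-(ContinuousLinearMap.id ℂ ℂ))) n fun _ => -z) =
      (∏ j ∈ Finset.range n, (a + j) / (1 + j)) * z ^ n := by
    intro n
    have := hypCoeff_eq a 1 1 n
    rw [FormalMultilinearSeries.compContinuousLinearMap_apply]
    have e2 : (⇑(-(ContinuousLinearMap.id ℂ ℂ)) ∘ fun _ : Fin n => -z) = fun _ => z := by
      ext; simp
    rw [e2, ordinaryHypergeometricSeries_apply_eq, neg_neg, smul_eq_mul]
    rw [Complex.ofReal_one] at this
    rw [← this, hypCoeff]
    congr 1
    refine Finset.prod_congr rfl fun j _ => ?_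
    have : (1 + (j : ℂ)) ≠ 0 := by
      rw [add_comm]; exact Nat.cast_add_one_ne_zero j
    simp only [Complex.ofReal_one]
    field_simp
  simp only [e] at h
  simpa [sub_eq_add_neg] using h

/-- Follows from the functional equation of Γ. The product is the ratio (u)ₙ / (u + v)ₙ that appears
when Euler's integral is expanded term by term. -/
lemma betaIntegral_add_nat {u v : ℂ} (hu : 0 < u.re) (hv : 0 < v.re) (n : ℕ) :
    Complex.betaIntegral (u + n) v =
      Complex.betaIntegral u v * ∏ j ∈ Finset.range n, (u + j) / (u + v + j) := by
  induction n with
  | zero => simp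
  | succ n ih =>
    have hun : 0 < (u + n).re := by simp; positivity
    have h1 := Complex.betaIntegral_recurrence hun hv
    have h2 := Complex.Gamma_mul_Gamma_eq_betaIntegral (s := u + (n + 1 : ℕ)) (t := v)
      (by simp; positivity) hv
    have h3 := Complex.Gamma_mul_Gamma_eq_betaIntegral (s := u + n) (t := v) hun hv
    have h0 : u + n ≠ 0 := fun h => by simp [h] at hun
    have h00 : u + n + v ≠ 0 := fun h => by
      have := congrArg Complex.re h; simp at this; simp at hun; linarith
    have h4 := Complex.Gamma_add_one (u + n) h0
    have h5 := Complex.Gamma_add_one (u + n + v) h00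
    have hg : Complex.Gamma (u + n + v) ≠ 0 :=
      Complex.Gamma_ne_zero_of_re_pos (by simp; simp at hun; linarith)
    rw [show u + (n + 1 : ℕ) = u + n + 1 by push_cast; ring, h4,
      show u + n + 1 + v = u + n + v + 1 by ring, h5, mul_assoc, h3] at h2
    rw [show u + (n + 1 : ℕ) = u + n + 1 by push_cast; ring, Finset.prod_range_succ, ← mul_assoc,
      ← ih, show u + v + n = u + n + v by ring]
    field_simp
    apply mul_left_cancel₀ hg
    linear_combination -h2

lemma one_sub_mul_pos {s z : ℝ} (hs : s ∈ Set.Icc (0 : ℝ) 1) (hz : z < 1) : 0 < 1 - s * z := by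
  obtain ⟨h0, h1⟩ := hs
  rcases le_or_gt z 0 with h | h
  · nlinarith
  · nlinarith

lemma betaIntegrand_intervalIntegrable {u v : ℂ} (hu : 0 < u.re) (hv : 0 < v.re) :
    IntervalIntegrable (fun s : ℝ => (s : ℂ) ^ (u - 1) * (1 - (s : ℂ)) ^ (v - 1))
      MeasureTheory.volume 0 1 := Complex.betaIntegral_convergent hu hv

/-- Euler's integral for the Gauss sum. -/
lemma euler_integral_hypSum (a : ℂ) {b : ℂ} {c : ℝ} (hb : 0 < b.re) (hbc : b.re < c) {z : ℂ}
    (hz : ‖z‖ < 1) :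
    ∫ s in (0 : ℝ)..1, (s : ℂ) ^ (b - 1) * (1 - (s : ℂ)) ^ ((c : ℂ) - b - 1) * (1 - s * z) ^ (-a) =
      Complex.betaIntegral b (c - b) * hypSum a b c z := by
  have hv : 0 < ((c : ℂ) - b).re := by simpa using hbc
  have hc : 0 < c := hb.trans hbc
  set C : ℕ → ℂ := fun n => ∏ j ∈ Finset.range n, (a + j) / (1 + j) with hC
  have hCn : ∀ n, C n = hypCoeff a 1 1 n := by
    intro n
    refine Finset.prod_congr rfl fun j _ => ?_
    have : (1 + (j : ℂ)) ≠ 0 := by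
      rw [add_comm]; exact Nat.cast_add_one_ne_zero j
    simp only [Complex.ofReal_one]
    field_simp
  have hsum := summable_norm_hyp a 1 (c := 1) one_pos hz
  -- The binomial series of the last factor is integrated termwise, dominated by the Beta weight
  -- times the absolute terms at z.
  have key := intervalIntegral.hasSum_integral_of_dominated_convergence (μ := MeasureTheory.volume)
    (a := 0) (b := 1)
    (F := fun n (s : ℝ) => (s : ℂ) ^ (b - 1) * (1 - (s : ℂ)) ^ ((c : ℂ) - b - 1) * (C n * (s * z) ^ n))
    (f := fun s : ℝ => (s : ℂ) ^ (b - 1) * (1 - (s : ℂ)) ^ ((c : ℂ) - b - 1) * (1 - s * z) ^ (-a))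
    (fun n s => ‖(s : ℂ) ^ (b - 1) * (1 - (s : ℂ)) ^ ((c : ℂ) - b - 1)‖ * ‖hypCoeff a 1 1 n * z ^ n‖)
    (fun n => ?_) (fun n => ?_) ?_ ?_ ?_
  · have hI : ∀ n, ∫ s in (0 : ℝ)..1, (s : ℂ) ^ (b - 1) * (1 - (s : ℂ)) ^ ((c : ℂ) - b - 1) *
        (C n * (s * z) ^ n) = Complex.betaIntegral b (c - b) * (hypCoeff a b c n * z ^ n) := by
      intro n
      have h1 : ∫ s in (0 : ℝ)..1, (s : ℂ) ^ (b - 1) * (1 - (s : ℂ)) ^ ((c : ℂ) - b - 1) *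
        (C n * (s * z) ^ n) = ∫ s in (0 : ℝ)..1, (C n * z ^ n) *
          ((s : ℂ) ^ (b + n - 1) * (1 - (s : ℂ)) ^ ((c : ℂ) - b - 1)) := by
        refine intervalIntegral.integral_congr_ae (Filter.Eventually.of_forall fun s hs => ?_)
        rw [Set.uIoc_of_le zero_le_one] at hs
        have hs0 : (s : ℂ) ≠ 0 := by exact_mod_cast hs.1.ne'
        rw [show b + n - 1 = (b - 1) + (n : ℂ) by ring, Complex.cpow_add _ _ hs0,
          Complex.cpow_natCast]
        ring
      rw [h1, intervalIntegral.integral_const_mul]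
      change C n * z ^ n * Complex.betaIntegral (b + n) (c - b) = _
      rw [betaIntegral_add_nat hb hv, hC, hypCoeff]
      simp only [Finset.prod_div_distrib, Finset.prod_mul_distrib, add_sub_cancel]
      ring
    simp only [hI] at key
    exact key.unique ((hasSum_hypSum a b hc hz).mul_left _)
  · rw [Set.uIoc_of_le zero_le_one]
    refine ((betaIntegrand_intervalIntegrable hb hv).aestronglyMeasurable).mul ?_
    exact (by fun_prop : Continuous fun s : ℝ => C n * (s * z) ^ n).aestronglyMeasurable
  · refine Filter.Eventually.of_forall fun s hs => ?_
    rw [Set.uIoc_of_le zero_le_one] at hs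
    rw [norm_mul]
    refine mul_le_mul_of_nonneg_left ?_ (norm_nonneg _)
    rw [hCn, norm_mul, norm_mul, norm_pow, norm_pow, norm_mul, Complex.norm_of_nonneg hs.1.le]
    refine mul_le_mul_of_nonneg_left ?_ (norm_nonneg _)
    exact pow_le_pow_left₀ (mul_nonneg hs.1.le (norm_nonneg _))
      (mul_le_of_le_one_left (norm_nonneg _) hs.2) n
  · exact Filter.Eventually.of_forall fun s _ => hsum.mul_left _
  · simp only [tsum_mul_left]
    exact ((betaIntegrand_intervalIntegrable hb hv).norm).mul_const _
  · refine Filter.Eventually.of_forall fun s hs => ?_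
    rw [Set.uIoc_of_le zero_le_one] at hs
    refine HasSum.mul_left _ (hasSum_one_sub_cpow a ?_)
    rw [norm_mul, Complex.norm_of_nonneg hs.1.le]
    exact (mul_le_of_le_one_left (norm_nonneg _) hs.2).trans_lt hz

/-- The substitution `s ↦ 1 - s` in Euler's integral. -/
lemma euler_integral_flip (a b d : ℂ) {z : ℝ} (hz : z < 1) :
    ∫ s in (0 : ℝ)..1, (s : ℂ) ^ (b - 1) * (1 - (s : ℂ)) ^ (d - 1) * (1 - s * (z : ℂ)) ^ (-a) =
      (1 - (z : ℂ)) ^ (-a) * ∫ s in (0 : ℝ)..1, (s : ℂ) ^ (d - 1) * (1 - (s : ℂ)) ^ (b - 1) *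
        (1 - s * ((z / (z - 1) : ℝ) : ℂ)) ^ (-a) := by
  rw [← intervalIntegral.integral_const_mul]
  have := intervalIntegral.integral_comp_sub_left (a := 0) (b := 1) (d := (1 : ℝ))
    (fun s : ℝ => (s : ℂ) ^ (b - 1) * (1 - (s : ℂ)) ^ (d - 1) * (1 - s * (z : ℂ)) ^ (-a))
  simp only [sub_self, sub_zero] at this
  rw [← this]
  refine intervalIntegral.integral_congr fun s hs => ?_
  rw [Set.uIcc_of_le zero_le_one] at hs
  have hw : z / (z - 1) < 1 := by
    rw [div_lt_iff_of_neg (by linarith)]; linarith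
  have h1 : (1 - ((1 - s : ℝ) : ℂ) * z) = ((1 - z : ℝ) : ℂ) * ((1 - s * (z / (z - 1)) : ℝ) : ℂ) := by
    have : z - 1 ≠ 0 := by linarith
    rw [← Complex.ofReal_mul, ← Complex.ofReal_mul, ← Complex.ofReal_one, ← Complex.ofReal_sub]
    congr 1
    field_simp
    ring
  have h2 : ((1 : ℂ) - ((1 - s : ℝ) : ℂ)) = s := by push_cast; ring
  have h3 : ((1 - s : ℝ) : ℂ) = 1 - (s : ℂ) := by push_cast; ring
  have h4 := Complex.mul_cpow_ofReal_nonneg (a := 1 - z) (b := 1 - s * (z / (z - 1)))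
    (by linarith) (one_sub_mul_pos hs hw).le (-a)
  simp only [h1, h2]
  rw [h4, h3]
  push_cast
  ring

lemma betaIntegral_ne_zero {u v : ℂ} (hu : 0 < u.re) (hv : 0 < v.re) :
    Complex.betaIntegral u v ≠ 0 := by
  rw [Complex.betaIntegral_eq_Gamma_mul_div u v hu hv]
  exact div_ne_zero (mul_ne_zero (Complex.Gamma_ne_zero_of_re_pos hu)
    (Complex.Gamma_ne_zero_of_re_pos hv))
    (Complex.Gamma_ne_zero_of_re_pos (by rw [Complex.add_re]; linarith))

lemma abs_div_sub_one_lt_one {z : ℝ} (hz : z < 1 / 2) : |z / (z - 1)| < 1 := by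
  rw [abs_div, div_lt_one (by rw [abs_pos]; linarith), abs_of_neg (by linarith : z - 1 < 0), abs_lt]
  constructor <;> linarith

/-- Pfaff's transformation. -/
lemma pfaff_hypSum (a b : ℂ) {c : ℝ} (hc : 0 < c) {z : ℝ} (hz : -1 < z) (hz' : z < 1 / 2) :
    hypSum a b c z = (1 - (z : ℂ)) ^ (-a) * hypSum a (c - b) c ((z / (z - 1) : ℝ) : ℂ) := by
  have hz1 : ‖(z : ℂ)‖ < 1 := by
    rw [Complex.norm_real, Real.norm_eq_abs, abs_lt]; constructor <;> linarith
  have hw1 : ‖((z / (z - 1) : ℝ) : ℂ)‖ < 1 := by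
    rw [Complex.norm_real, Real.norm_eq_abs]; exact abs_div_sub_one_lt_one hz'
  -- Both sides are entire in `b`, so it is enough to compare them near c/2, where Euler's integral
  -- converges on both sides.
  have hl : Differentiable ℂ fun b => hypSum a b c z :=
    differentiable_hypSum_param (differentiable_const a) differentiable_id hc hz1
  have hr : Differentiable ℂ fun b => (1 - (z : ℂ)) ^ (-a) *
      hypSum a (c - b) c ((z / (z - 1) : ℝ) : ℂ) :=
    (differentiable_hypSum_param (p := fun _ => a) (q := fun b => c - b) (differentiable_const a)
      (by fun_prop) hc hw1).const_mul _
  have hl' := hl.differentiableOn.analyticOnNhd isOpen_univ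
  have hr' := hr.differentiableOn.analyticOnNhd isOpen_univ
  refine congrFun (hl'.eq_of_eventuallyEq hr' (z₀ := ((c / 2 : ℝ) : ℂ)) ?_) b
  have hopen : IsOpen {b : ℂ | 0 < b.re ∧ b.re < c} :=
    (isOpen_lt continuous_const Complex.continuous_re).inter
      (isOpen_lt Complex.continuous_re continuous_const)
  filter_upwards [hopen.mem_nhds (show ((c / 2 : ℝ) : ℂ) ∈ _ by
    simp only [Set.mem_ofPred_eq, Complex.ofReal_re]; constructor <;> linarith)] with b hb
  have hv : 0 < ((c : ℂ) - b).re := by simpa using hb.2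
  apply mul_left_cancel₀ (betaIntegral_ne_zero hb.1 hv)
  rw [← euler_integral_hypSum a hb.1 hb.2 hz1, euler_integral_flip _ _ _ (by linarith),
    Complex.betaIntegral_symm, mul_left_comm]
  have := euler_integral_hypSum a hv (c := c) (by simpa using hb.1) hw1
  simp only [sub_sub_cancel] at this
  rw [this]

/-! ### The continuation to (-∞, 1) and its transformations -/

/-- The continuation of the Gauss sum to `(-∞, 1)`. -/
noncomputable def hypReal (a b : ℂ) (c z : ℝ) : ℂ :=
  if 0 ≤ z then hypSum a b c z
  else (1 - (z : ℂ)) ^ (-a) * hypSum a (c - b) c ((z / (z - 1) : ℝ) : ℂ)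

/-- Together with `hypReal_eq_pfaff` this shows that the two branches agree on (-1, 1/2), so
analyticity can be checked with either formula. -/
lemma hypReal_eq_hypSum (a b : ℂ) {c : ℝ} (hc : 0 < c) {z : ℝ} (hz : |z| < 1) :
    hypReal a b c z = hypSum a b c z := by
  rw [hypReal]
  split_ifs with h
  · rfl
  · rw [pfaff_hypSum a b hc (abs_lt.mp hz).1 (by linarith)]

lemma hypReal_eq_pfaff (a b : ℂ) {c : ℝ} (hc : 0 < c) {z : ℝ} (hz : z < 1 / 2) :
    hypReal a b c z = (1 - (z : ℂ)) ^ (-a) * hypSum a (c - b) c ((z / (z - 1) : ℝ) : ℂ) := by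
  rw [hypReal]
  split_ifs with h
  · rw [pfaff_hypSum a b hc (by linarith) hz]
  · rfl

lemma analyticAt_hypSum_comp (a b : ℂ) {c : ℝ} (hc : 0 < c) {f : ℝ → ℝ} {z : ℝ}
    (hf : AnalyticAt ℝ f z) (hz : |f z| < 1) :
    AnalyticAt ℝ (fun z => hypSum a b c (f z : ℂ)) z := by
  have h1 : AnalyticAt ℂ (hypSum a b c) (f z : ℂ) :=
    (differentiableOn_hypSum a b hc).analyticAt (Metric.isOpen_ball.mem_nhds (by simpa using hz))
  exact (h1.restrictScalars (𝕜 := ℝ)).comp_of_eq ((Complex.ofRealCLM.analyticAt _).comp hf) rfl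

lemma analyticAt_one_sub_cpow (a : ℂ) {z : ℝ} (hz : z < 1) :
    AnalyticAt ℝ (fun z : ℝ => (1 - (z : ℂ)) ^ a) z := by
  have h1 : AnalyticAt ℂ (fun w : ℂ => (1 - w) ^ a) (z : ℂ) := by
    refine AnalyticAt.cpow (by fun_prop) analyticAt_const ?_
    left; simp; linarith
  exact (h1.restrictScalars (𝕜 := ℝ)).comp_of_eq (Complex.ofRealCLM.analyticAt z) rfl

lemma analyticOnNhd_hypReal (a b : ℂ) {c : ℝ} (hc : 0 < c) :
    AnalyticOnNhd ℝ (hypReal a b c) (Set.Iio 1) := by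
  intro z hz
  rw [Set.mem_Iio] at hz
  rcases lt_or_ge z (1 / 2) with h | h
  · have : AnalyticAt ℝ (fun z : ℝ => (1 - (z : ℂ)) ^ (-a) *
        hypSum a (c - b) c ((z / (z - 1) : ℝ) : ℂ)) z := by
      refine (analyticAt_one_sub_cpow _ hz).mul (analyticAt_hypSum_comp a _ hc ?_
        (abs_div_sub_one_lt_one h))
      exact AnalyticAt.div analyticAt_id (by fun_prop) (by simp; linarith)
    refine this.congr ?_
    filter_upwards [isOpen_Iio.mem_nhds h] with w hw
    exact (hypReal_eq_pfaff a b hc hw).symm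
  · have hz1 : |z| < 1 := by rw [abs_lt]; constructor <;> linarith
    refine (analyticAt_hypSum_comp a b hc (analyticAt_id) hz1).congr ?_
    filter_upwards [(isOpen_lt continuous_abs continuous_const).mem_nhds hz1] with w hw
    exact (hypReal_eq_hypSum a b hc hw).symm

lemma isGaussContinuation_hypReal (a b : ℂ) {c : ℝ} (hc : 0 < c) :
    IsGaussContinuation a b c (hypReal a b c) :=
  ⟨analyticOnNhd_hypReal a b hc, fun z hz => by
    rw [hypReal_eq_hypSum a b hc hz, ordinaryHypergeometric_eq_hypSum]⟩

/-- Uniqueness identifies the function picked by choice in `hyp2F1` with the explicit `hypReal`. -/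
lemma IsGaussContinuation.eqOn {a b c : ℂ} {F F' : ℝ → ℂ} (h : IsGaussContinuation a b c F)
    (h' : IsGaussContinuation a b c F') : Set.EqOn F F' (Set.Iio 1) := by
  refine h.1.eqOn_of_preconnected_of_eventuallyEq h'.1 isPreconnected_Iio
    (show (0 : ℝ) ∈ Set.Iio 1 by simp) ?_
  filter_upwards [(isOpen_lt continuous_abs continuous_const).mem_nhds
    (show (0 : ℝ) ∈ {z : ℝ | |z| < 1} by simp)] with z hz
  rw [h.2 z hz, h'.2 z hz]

lemma hyp2F1_eq_hypReal (a b : ℂ) {c : ℝ} (hc : 0 < c) {z : ℝ} (hz : z < 1) :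
    hyp2F1 a b c z = hypReal a b c z := by
  have h : ∃ F : ℝ → ℂ, IsGaussContinuation a b c F := ⟨_, isGaussContinuation_hypReal a b hc⟩
  rw [hyp2F1, dif_pos h]
  exact h.choose_spec.eqOn (isGaussContinuation_hypReal a b hc) hz

/-- Euler's integral on `(-∞, 1)`. -/
lemma euler_integral_hypReal (a : ℂ) {b : ℂ} {c : ℝ} (hb : 0 < b.re) (hbc : b.re < c) {z : ℝ}
    (hz : z < 1) :
    ∫ s in (0 : ℝ)..1, (s : ℂ) ^ (b - 1) * (1 - (s : ℂ)) ^ ((c : ℂ) - b - 1) *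
      (1 - s * (z : ℂ)) ^ (-a) = Complex.betaIntegral b (c - b) * hypReal a b c z := by
  have hv : 0 < ((c : ℂ) - b).re := by simpa using hbc
  rw [hypReal]
  split_ifs with h
  · refine euler_integral_hypSum a hb hbc ?_
    rw [Complex.norm_real, Real.norm_eq_abs, abs_lt]; constructor <;> linarith
  · have := euler_integral_hypSum a hv (c := c) (by simpa using hb)
      (z := ((z / (z - 1) : ℝ) : ℂ))
      (by rw [Complex.norm_real, Real.norm_eq_abs]; exact abs_div_sub_one_lt_one (by linarith))
    simp only [sub_sub_cancel] at this
    rw [euler_integral_flip _ _ _ hz, Complex.betaIntegral_symm, mul_left_comm, this]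

/-- Pfaff's transformation on `(-∞, 1)`. -/
lemma pfaff_hypReal (a b : ℂ) {c : ℝ} (hc : 0 < c) {z : ℝ} (hz : z < 1) :
    hypReal a b c z = (1 - (z : ℂ)) ^ (-a) * hypReal a (c - b) c (z / (z - 1)) := by
  rcases lt_or_ge z (1 / 2) with h | h
  · rw [hypReal_eq_pfaff a b hc h, hypReal_eq_hypSum _ _ hc (abs_div_sub_one_lt_one h)]
  -- The map z ↦ z / (z - 1) is an involution, so the case already known, applied at the image
  -- point, gives the inverse relation.
  · have h1 : z - 1 < 0 := by linarith
    have hw : z / (z - 1) < 1 / 2 := by rw [div_lt_iff_of_neg h1]; linarith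
    have e : z / (z - 1) / (z / (z - 1) - 1) = z := by
      rw [div_sub_one h1.ne, show z - (z - 1) = 1 by ring, div_div_div_cancel_right₀ h1.ne, div_one]
    have e2 : ((1 : ℂ) - ((z / (z - 1) : ℝ) : ℂ)) = (1 - (z : ℂ))⁻¹ := by
      have : (z : ℂ) - 1 ≠ 0 := by
        rw [← Complex.ofReal_one, ← Complex.ofReal_sub, Complex.ofReal_ne_zero]; exact h1.ne
      have h2 : (1 - (z : ℂ)) ≠ 0 := by
        rw [← neg_sub]; exact neg_ne_zero.mpr this
      push_cast
      field_simp
      ring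
    have h2 : (1 - (z : ℂ)) ≠ 0 := by
      rw [← Complex.ofReal_one, ← Complex.ofReal_sub, Complex.ofReal_ne_zero]; linarith
    have h3 : (1 - (z : ℂ)).arg ≠ Real.pi := by
      rw [← Complex.ofReal_one, ← Complex.ofReal_sub, Complex.arg_ofReal_of_nonneg (by linarith)]
      exact Real.pi_ne_zero.symm
    rw [hypReal_eq_pfaff a _ hc hw, e, e2, sub_sub_cancel, Complex.inv_cpow _ _ h3, ← mul_assoc,
      mul_inv_cancel₀ (by simp [Complex.cpow_eq_zero_iff, h2]), one_mul,
      hypReal_eq_hypSum _ _ hc (by rw [abs_lt]; constructor <;> linarith)]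

lemma hypReal_symm (a b : ℂ) {c : ℝ} (hc : 0 < c) {z : ℝ} (hz : z < 1) :
    hypReal a b c z = hypReal b a c z := by
  refine (isGaussContinuation_hypReal a b hc).eqOn (F' := hypReal b a c) ?_ hz
  refine ⟨analyticOnNhd_hypReal b a hc, fun z hz => ?_⟩
  rw [hypReal_eq_hypSum b a hc hz, ordinaryHypergeometric_eq_hypSum, hypSum_symm]

/-- Euler's transformation on `(-∞, 1)`. -/
lemma euler_hypReal (a b : ℂ) {c : ℝ} (hc : 0 < c) {z : ℝ} (hz : z < 1) :
    hypReal a b c z = (1 - (z : ℂ)) ^ (c - a - b) * hypReal (c - a) (c - b) c z := by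
  have h2 : (1 - (z : ℂ)) ≠ 0 := by
    rw [← Complex.ofReal_one, ← Complex.ofReal_sub, Complex.ofReal_ne_zero]; linarith
  have hw : z / (z - 1) < 1 := by
    rw [div_lt_iff_of_neg (by linarith)]; linarith
  -- Pfaff's transformation, applied to both sides in different upper parameters, leads to the same
  -- function of z / (z - 1).
  rw [hypReal_symm a b hc hz, pfaff_hypReal b a hc hz, pfaff_hypReal (c - a) (c - b) hc hz,
    hypReal_symm _ _ hc hw, sub_sub_cancel, ← mul_assoc, ← Complex.cpow_add _ _ h2]
  congr 2
  ring

/-- A polynomial bound for the continuation, uniform for bounded parameters. -/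
lemma norm_hypReal_le {a b : ℂ} {c A B : ℝ} (hc : 0 < c) {D : ℕ} (hA : ‖a‖ ≤ A) (hB : ‖b‖ ≤ B)
    (h1 : A * (B + c) ≤ (D + 1) * c) (h2 : A + (B + c) ≤ D) {z : ℝ} (hz : z < 1) :
    ‖hypReal a b c z‖ ≤ ((1 - z)⁻¹) ^ (D + 1) + (1 - z) ^ (A + D + 1) := by
  have hA0 := (norm_nonneg _).trans hA
  have hz1 : 0 < 1 - z := by linarith
  rw [hypReal]
  split_ifs with h
  · have := norm_hypSum_le (a := a) (b := b) (z := (z : ℂ)) hc hA hB (D := D) (by nlinarith)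
      (by linarith) (by rw [Complex.norm_real, Real.norm_of_nonneg h]; exact hz)
    rw [Complex.norm_real, Real.norm_of_nonneg h] at this
    have h3 : 0 ≤ (1 - z) ^ (A + D + 1) := by positivity
    linarith
  · push Not at h
    have hw0 : 0 ≤ z / (z - 1) := div_nonneg_of_nonpos h.le (by linarith)
    have hw1 : |z / (z - 1)| < 1 := abs_div_sub_one_lt_one (by linarith)
    have hcb : ‖(c : ℂ) - b‖ ≤ B + c := (norm_sub_le _ _).trans (by
      rw [Complex.norm_of_nonneg hc.le]; linarith)
    have := norm_hypSum_le (a := a) (b := c - b) (z := ((z / (z - 1) : ℝ) : ℂ)) hc hA hcb h1 h2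
      (by rwa [Complex.norm_real])
    rw [Complex.norm_real, Real.norm_of_nonneg hw0,
      show 1 - z / (z - 1) = (1 - z)⁻¹ by
        have : z - 1 ≠ 0 := by linarith
        field_simp; ring, inv_inv] at this
    have h4 : ‖(1 - (z : ℂ)) ^ (-a)‖ ≤ (1 - z) ^ A := by
      rw [← Complex.ofReal_one, ← Complex.ofReal_sub,
        Complex.norm_cpow_eq_rpow_re_of_pos hz1]
      refine Real.rpow_le_rpow_of_exponent_le (by linarith) ?_
      have := Complex.abs_re_le_norm a
      have := neg_abs_le a.re
      simp; linarith
    have h3 : 0 ≤ ((1 - z)⁻¹) ^ (D + 1) := by positivity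
    calc _ ≤ (1 - z) ^ A * (1 - z) ^ (D + 1) := by
          rw [norm_mul]; gcongr
      _ = (1 - z) ^ (A + D + 1) := by
          rw [add_assoc, Real.rpow_add hz1, ← Real.rpow_natCast]; push_cast; rfl
      _ ≤ _ := by linarith

/-- The continuation is holomorphic in its parameters. -/
lemma differentiable_hypReal_param {p q : ℂ → ℂ} (hp : Differentiable ℂ p)
    (hq : Differentiable ℂ q) {c : ℝ} (hc : 0 < c) {z : ℝ} (hz : z < 1) :
    Differentiable ℂ fun μ => hypReal (p μ) (q μ) c z := by
  have h0 : (1 - (z : ℂ)) ≠ 0 := by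
    rw [← Complex.ofReal_one, ← Complex.ofReal_sub, Complex.ofReal_ne_zero]; linarith
  unfold hypReal
  split_ifs with h
  · refine differentiable_hypSum_param hp hq hc ?_
    rw [Complex.norm_real, Real.norm_of_nonneg h]; exact hz
  · refine Differentiable.mul ?_ (differentiable_hypSum_param hp ((differentiable_const _).sub hq) hc ?_)
    · exact hp.neg.const_cpow (Or.inl h0)
    · rw [Complex.norm_real]; exact abs_div_sub_one_lt_one (by linarith)

/-! ### Holomorphy of parameter integrals -/

open MeasureTheory in
/-- Integrals of holomorphic functions of a parameter are holomorphic, given locally uniform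
integrable bounds. -/
lemma differentiableOn_integral_of_locally_dominated {X : Type*} [MeasurableSpace X] {ν : Measure X}
    {U : Set ℂ} (hU : IsOpen U) {K : ℂ → X → ℂ} (hm : ∀ μ ∈ U, AEStronglyMeasurable (K μ) ν)
    (hd : ∀ᵐ x ∂ν, DifferentiableOn ℂ (fun μ => K μ x) U)
    (hb : ∀ μ₀ ∈ U, ∃ V ∈ nhds μ₀, ∃ g : X → ℝ, Integrable g ν ∧
      ∀ᵐ x ∂ν, ∀ μ ∈ V, ‖K μ x‖ ≤ g x) :
    DifferentiableOn ℂ (fun μ => ∫ x, K μ x ∂ν) U := by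
  intro μ₀ hμ₀
  obtain ⟨V, hV, g, hg, hKg⟩ := hb μ₀ hμ₀
  obtain ⟨r, hr, hball⟩ := Metric.mem_nhds_iff.mp (Filter.inter_mem hV (hU.mem_nhds hμ₀))
  have hint : Integrable (K μ₀) ν :=
    hg.mono' (hm _ hμ₀) (by filter_upwards [hKg] with x hx using hx μ₀ (mem_of_mem_nhds hV))
  -- The derivative is a limit of difference quotients along μ₀ + r / (n + 2); the shift by 2 keeps
  -- these points inside the ball.
  have hDm : AEStronglyMeasurable (fun x => deriv (fun μ => K μ x) μ₀) ν := by
    set h : ℕ → ℂ := fun n => μ₀ + ((r / (n + 2) : ℝ) : ℂ) with hh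
    have hpos : ∀ n : ℕ, 0 < r / ((n : ℝ) + 2) := fun n => by positivity
    have hhU : ∀ n, h n ∈ U := by
      intro n
      refine (hball ?_).2
      rw [Metric.mem_ball, dist_eq_norm, hh]
      simp only [add_sub_cancel_left, Complex.norm_real, Real.norm_of_nonneg (hpos n).le]
      rw [div_lt_iff₀ (by positivity)]
      nlinarith [(Nat.cast_nonneg n : (0 : ℝ) ≤ n)]
    have hlim : Filter.Tendsto h Filter.atTop (nhdsWithin μ₀ {μ₀}ᶜ) := by
      refine tendsto_nhdsWithin_iff.mpr ⟨?_, Filter.Eventually.of_forall fun n => ?_⟩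
      · have h1 : Filter.Tendsto (fun n : ℕ => r / ((n : ℝ) + 2)) Filter.atTop (nhds 0) :=
          (tendsto_const_nhds (x := r)).div_atTop
            (Filter.tendsto_atTop_add_const_right _ _ tendsto_natCast_atTop_atTop)
        have h2 := (Complex.continuous_ofReal.tendsto 0).comp h1
        simpa [hh] using h2.const_add μ₀
      · simp only [hh, Set.mem_compl_iff, Set.mem_singleton_iff, add_eq_left,
          Complex.ofReal_eq_zero]
        exact (hpos n).ne'
    refine aestronglyMeasurable_of_tendsto_ae Filter.atTop
      (f := fun n x => slope (fun μ => K μ x) μ₀ (h n)) (fun n => ?_) ?_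
    · simp only [slope_def_module]
      exact ((hm _ (hhU n)).sub (hm _ hμ₀)).const_smul (h n - μ₀)⁻¹
    · filter_upwards [hd] with x hx
      exact ((hx.differentiableAt (hU.mem_nhds hμ₀)).hasDerivAt.tendsto_slope).comp hlim
  -- Cauchy's estimate on circles of radius r/2 bounds the derivative by g / (r/2).
  refine (hasDerivAt_integral_of_dominated_loc_of_deriv_le (s := Metric.ball μ₀ (r / 2))
    (bound := fun x => g x / (r / 2)) (F' := fun μ x => deriv (fun μ => K μ x) μ)
    (Metric.ball_mem_nhds _ (by positivity)) ?_ hint hDm ?_ (hg.div_const _) ?_).2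
    |>.differentiableAt.differentiableWithinAt
  · filter_upwards [hU.mem_nhds hμ₀] with μ hμ using hm μ hμ
  · filter_upwards [hKg, hd] with x hx hdx μ hμ
    have hsub : Metric.closedBall μ (r / 2) ⊆ Metric.ball μ₀ r := by
      intro y hy
      rw [Metric.mem_ball] at hμ ⊢
      rw [Metric.mem_closedBall] at hy
      linarith [dist_triangle y μ μ₀]
    refine Complex.norm_deriv_le_of_forall_mem_sphere_norm_le (by positivity) ?_ fun z hz => ?_
    · refine DifferentiableOn.diffContOnCl ?_
      exact hdx.mono ((Metric.closure_ball_subset_closedBall.trans hsub).trans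
        (hball.trans Set.inter_subset_right))
    · exact hx z (hball (hsub (Metric.sphere_subset_closedBall hz))).1
  · filter_upwards [hd] with x hx μ hμ
    exact (hx.differentiableAt (hU.mem_nhds
      (hball (Metric.ball_subset_ball (by linarith) hμ)).2)).hasDerivAt

/-! ### Bounds for 1 + s w and its powers on the slit plane -/

lemma isPreconnected_slitPlane : IsPreconnected Complex.slitPlane :=
  (Complex.starConvex_one_slitPlane.isPathConnected Complex.one_mem_slitPlane).isConnected.isPreconnected

lemma one_add_mul_mem_slitPlane {w : ℂ} (hw : w ∈ Complex.slitPlane) {s : ℝ} (hs : 0 ≤ s) :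
    1 + s * w ∈ Complex.slitPlane := by
  rw [Complex.mem_slitPlane_iff] at hw ⊢
  rcases hs.eq_or_lt with rfl | hs
  · left; simp
  · rcases hw with hw | hw
    · left; simp; positivity
    · right; simp [hs.ne', hw]

lemma norm_add_re_pos {w : ℂ} (hw : w ∈ Complex.slitPlane) : 0 < ‖w‖ + w.re := by
  rw [Complex.mem_slitPlane_iff] at hw
  rcases hw with hw | hw
  · positivity
  · have := (Complex.abs_re_lt_norm).mpr hw
    linarith [neg_abs_le w.re]

/-- A lower bound for `|1 + s w|` that is uniform in `s ≥ 0`. -/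
lemma le_norm_one_add_mul {w : ℂ} (hw : w ∈ Complex.slitPlane) {s : ℝ} (hs : 0 ≤ s) :
    (‖w‖ + w.re) / (2 * ‖w‖) ≤ ‖1 + s * w‖ := by
  have hw0 : 0 < ‖w‖ := norm_pos_iff.mpr (Complex.slitPlane_ne_zero hw)
  have hre : w.re ≤ ‖w‖ := Complex.re_le_norm w
  have hpos := norm_add_re_pos hw
  rw [div_le_iff₀ (by positivity)]
  refine abs_le_of_sq_le_sq' ?_ (by positivity) |>.2
  have h1 : ‖1 + s * w‖ ^ 2 = 1 + 2 * s * w.re + s ^ 2 * ‖w‖ ^ 2 := by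
    rw [Complex.sq_norm, Complex.sq_norm, Complex.normSq_apply, Complex.normSq_apply]
    simp
    ring
  rw [mul_pow, h1]
  rcases le_or_gt 0 w.re with h | h
  · nlinarith [mul_nonneg hs h, sq_nonneg (s * ‖w‖), sq_nonneg ‖w‖]
  -- Completing the square in s; since Re w < 0, ‖w‖ - Re w dominates ‖w‖ + Re w.
  · have h2 : (1 + 2 * s * w.re + s ^ 2 * ‖w‖ ^ 2) * (2 * ‖w‖) ^ 2 =
        4 * (s * ‖w‖ ^ 2 + w.re) ^ 2 + 4 * ((‖w‖ - w.re) * (‖w‖ + w.re)) := by ring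
    rw [h2]
    nlinarith [sq_nonneg (s * ‖w‖ ^ 2 + w.re)]

/-- Local uniform two-sided bounds for `|1 + s w|`. -/
lemma exists_nhds_one_add_mul_bounds {w₀ : ℂ} (hw₀ : w₀ ∈ Complex.slitPlane) :
    ∃ V ∈ nhds w₀, V ⊆ Complex.slitPlane ∧ ∃ M : ℝ, 1 ≤ M ∧ ∀ w ∈ V, ∀ s : ℝ, 0 ≤ s →
      ‖1 + s * w‖ ≤ M * (1 + s) ∧ ‖1 + s * w‖⁻¹ ≤ M := by
  have hn0 : 0 < ‖w₀‖ := norm_pos_iff.mpr (Complex.slitPlane_ne_zero hw₀)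
  set κ : ℂ → ℝ := fun w => (‖w‖ + w.re) / (2 * ‖w‖) with hκ
  have hκ0 : 0 < κ w₀ := by have := norm_add_re_pos hw₀; positivity
  have hcont : ContinuousAt κ w₀ := by
    refine ContinuousAt.div ?_ ?_ (by positivity)
    · exact (continuous_norm.add Complex.continuous_re).continuousAt
    · exact (continuous_const.mul continuous_norm).continuousAt
  have h1 : ∀ᶠ w in nhds w₀, κ w₀ / 2 < κ w := hcont.eventually_const_lt (by linarith)
  have h2 : ∀ᶠ w in nhds w₀, ‖w‖ < ‖w₀‖ + 1 :=
    continuous_norm.continuousAt.eventually_lt_const (by linarith)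
  have h3 : ∀ᶠ w in nhds w₀, w ∈ Complex.slitPlane := Complex.isOpen_slitPlane.mem_nhds hw₀
  refine ⟨{w | κ w₀ / 2 < κ w ∧ ‖w‖ < ‖w₀‖ + 1 ∧ w ∈ Complex.slitPlane}, h1.and (h2.and h3),
    fun w hw => hw.2.2, max (‖w₀‖ + 1) ((κ w₀ / 2)⁻¹), le_max_of_le_left (by linarith), ?_⟩
  rintro w ⟨hw1, hw2, hw3⟩ s hs
  constructor
  · have h4 : ‖1 + s * w‖ ≤ 1 + s * ‖w‖ := (norm_add_le _ _).trans (by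
      rw [norm_mul, Complex.norm_of_nonneg hs, norm_one])
    have h5 : s * ‖w‖ ≤ s * (‖w₀‖ + 1) := mul_le_mul_of_nonneg_left hw2.le hs
    have h6 : (‖w₀‖ + 1) * (1 + s) ≤ max (‖w₀‖ + 1) ((κ w₀ / 2)⁻¹) * (1 + s) :=
      mul_le_mul_of_nonneg_right (le_max_left _ _) (by linarith)
    nlinarith
  · refine le_max_of_le_right ?_
    exact inv_anti₀ (by positivity) (hw1.le.trans (le_norm_one_add_mul hw3 hs))

/-- A nonnegative exponent uses the bound on r, a negative one the bound on r⁻¹; the result no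
longer depends on the exponent. -/
lemma rpow_le_of_bounds {r M T x : ℝ} {N : ℕ} (hr : 0 < r) (hM : 1 ≤ M) (hT : 1 ≤ T)
    (h1 : r ≤ M * T) (h2 : r⁻¹ ≤ M) (hx : |x| ≤ N) : r ^ x ≤ M ^ N * T ^ N := by
  have hx' := abs_le.mp hx
  have hMT : 1 ≤ M * T := one_le_mul_of_one_le_of_one_le hM hT
  rw [← mul_pow, ← Real.rpow_natCast]
  rcases le_or_gt 0 x with h | h
  · calc r ^ x ≤ (M * T) ^ x := Real.rpow_le_rpow hr.le h1 h
      _ ≤ (M * T) ^ (N : ℝ) := Real.rpow_le_rpow_of_exponent_le hMT hx'.2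
  · calc r ^ x = (r⁻¹) ^ (-x) := by rw [Real.inv_rpow hr.le, Real.rpow_neg hr.le, inv_inv]
      _ ≤ (M * T) ^ (-x) := Real.rpow_le_rpow (by positivity)
          (h2.trans (le_mul_of_one_le_right (by linarith) hT)) (by linarith)
      _ ≤ (M * T) ^ (N : ℝ) := Real.rpow_le_rpow_of_exponent_le hMT (by linarith)

/-- Local uniform polynomial bounds for `(1 + s w) ^ β`. -/
lemma exists_nhds_one_add_mul_cpow_bound {w₀ : ℂ} (hw₀ : w₀ ∈ Complex.slitPlane) (N : ℕ) :
    ∃ V ∈ nhds w₀, V ⊆ Complex.slitPlane ∧ ∃ C : ℝ, ∀ w ∈ V, ∀ s : ℝ, 0 ≤ s → ∀ β : ℂ, ‖β‖ ≤ N →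
      ‖(1 + s * w) ^ β‖ ≤ C * (1 + s) ^ N := by
  obtain ⟨V, hV, hVs, M, hM, hbd⟩ := exists_nhds_one_add_mul_bounds hw₀
  refine ⟨V, hV, hVs, M ^ N * Real.exp (Real.pi * N), fun w hw s hs β hβ => ?_⟩
  obtain ⟨h1, h2⟩ := hbd w hw s hs
  have hne := Complex.slitPlane_ne_zero (one_add_mul_mem_slitPlane (hVs hw) hs)
  have h3 : ‖1 + s * w‖ ^ β.re ≤ M ^ N * (1 + s) ^ N :=
    rpow_le_of_bounds (norm_pos_iff.mpr hne) hM (by linarith) h1 h2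
      ((Complex.abs_re_le_norm β).trans hβ)
  -- The imaginary part of the exponent contributes only a bounded factor, because the argument is
  -- at most π in modulus.
  have h4 : -((1 + s * w).arg * β.im) ≤ Real.pi * N := by
    refine (neg_le_abs _).trans ?_
    rw [abs_mul]
    exact mul_le_mul (Complex.abs_arg_le_pi _) ((Complex.abs_im_le_norm β).trans hβ)
      (abs_nonneg _) Real.pi_pos.le
  calc _ ≤ ‖1 + s * w‖ ^ β.re / Real.exp ((1 + s * w).arg * β.im) := Complex.norm_cpow_le _ _
    _ = ‖1 + s * w‖ ^ β.re * Real.exp (-((1 + s * w).arg * β.im)) := by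
        rw [Real.exp_neg, div_eq_mul_inv]
    _ ≤ (M ^ N * (1 + s) ^ N) * Real.exp (Real.pi * N) := by
        gcongr
    _ = _ := by ring

open MeasureTheory in
lemma integrableOn_rpow_mul_one_add_pow_mul_exp {σ : ℝ} (hσ : 0 < σ) (N : ℕ) :
    IntegrableOn (fun s : ℝ => s ^ (σ - 1) * (1 + s) ^ N * Real.exp (-s)) (Set.Ioi 0) := by
  have h : ∀ i ∈ Finset.range (N + 1), IntegrableOn (fun s : ℝ => (N.choose i : ℝ) *
      (Real.exp (-s) * s ^ ((σ + i) - 1))) (Set.Ioi 0) := fun i _ =>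
    (Real.GammaIntegral_convergent (by positivity)).const_mul _
  refine IntegrableOn.congr_fun (integrable_finsetSum _ h) (fun s hs => ?_) measurableSet_Ioi
  rw [Set.mem_Ioi] at hs
  simp only [add_comm (1 : ℝ) s, add_pow, one_pow, mul_one, Finset.mul_sum, Finset.sum_mul]
  refine Finset.sum_congr rfl fun i _ => ?_
  rw [show σ + i - 1 = (σ - 1) + (i : ℝ) by ring, Real.rpow_add hs, Real.rpow_natCast]
  ring

/-- The lower exponent dominates for s ≤ 1 and the upper one for s ≥ 1. This gives bounds uniform
over a range of exponents, as needed when μ varies. -/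
lemma rpow_le_add_rpow {s x y z : ℝ} (hs : 0 < s) (h1 : x ≤ y) (h2 : y ≤ z) :
    s ^ y ≤ s ^ x + s ^ z := by
  have hx : 0 < s ^ x := by positivity
  have hz : 0 < s ^ z := by positivity
  rcases le_or_gt 1 s with h | h
  · linarith [Real.rpow_le_rpow_of_exponent_le h h2]
  · linarith [Real.rpow_le_rpow_of_exponent_ge hs h.le h1]

open MeasureTheory

/-! ### The integral V: holomorphy and evenness in μ -/

/-- Laplace-type integral for Whittaker's function in the variable `w = 1 / z`:
`W_{k,μ}(z) = e^{-z/2} z^k V(1/2 - k, μ, 1/z)`. -/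
noncomputable def whittV (α μ w : ℂ) : ℂ :=
  (Complex.Gamma (α + μ))⁻¹ * ∫ s in Set.Ioi (0 : ℝ),
    (s : ℂ) ^ (α + μ - 1) * (1 + s * w) ^ (μ - α) * Complex.exp (-(s : ℂ))

lemma measurable_whittV_integrand (p q w : ℂ) :
    Measurable fun s : ℝ => (s : ℂ) ^ p * (1 + s * w) ^ q * Complex.exp (-(s : ℂ)) := by
  fun_prop

lemma norm_exp_neg_ofReal (s : ℝ) : ‖Complex.exp (-(s : ℂ))‖ = Real.exp (-s) := by
  rw [← Complex.ofReal_neg, Complex.norm_exp_ofReal]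

lemma norm_whittV_integrand_le {p q w : ℂ} {s C x y : ℝ} {N : ℕ} (hs : 0 < s) (h1 : x ≤ p.re)
    (h2 : p.re ≤ y) (h : ‖(1 + s * w) ^ q‖ ≤ C * (1 + s) ^ N) :
    ‖(s : ℂ) ^ p * (1 + s * w) ^ q * Complex.exp (-(s : ℂ))‖ ≤
      C * (s ^ x * (1 + s) ^ N * Real.exp (-s) + s ^ y * (1 + s) ^ N * Real.exp (-s)) := by
  rw [norm_mul, norm_mul, Complex.norm_cpow_eq_rpow_re_of_pos hs, norm_exp_neg_ofReal]
  have h3 := rpow_le_add_rpow hs h1 h2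
  calc _ ≤ (s ^ x + s ^ y) * (C * (1 + s) ^ N) * Real.exp (-s) := by
        gcongr
    _ = _ := by ring

lemma integrable_whittV_bound {σ τ : ℝ} (hσ : 0 < σ) (hτ : 0 < τ) (C : ℝ) (N : ℕ) :
    IntegrableOn (fun s : ℝ => C * (s ^ (σ - 1) * (1 + s) ^ N * Real.exp (-s) +
      s ^ (τ - 1) * (1 + s) ^ N * Real.exp (-s))) (Set.Ioi 0) :=
  ((integrableOn_rpow_mul_one_add_pow_mul_exp hσ N).add
    (integrableOn_rpow_mul_one_add_pow_mul_exp hτ N)).const_mul C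

lemma integrableOn_whittV_integrand {p : ℂ} (hp : 0 < p.re) (q : ℂ) {w : ℂ}
    (hw : w ∈ Complex.slitPlane) :
    IntegrableOn (fun s : ℝ => (s : ℂ) ^ (p - 1) * (1 + s * w) ^ q * Complex.exp (-(s : ℂ)))
      (Set.Ioi 0) := by
  obtain ⟨N, hN⟩ := exists_nat_ge ‖q‖
  obtain ⟨V, hV, -, C, hC⟩ := exists_nhds_one_add_mul_cpow_bound hw N
  refine (integrable_whittV_bound hp hp C N).mono'
    (measurable_whittV_integrand _ _ _).aestronglyMeasurable ?_
  refine (ae_restrict_iff' measurableSet_Ioi).mpr (Filter.Eventually.of_forall fun s hs => ?_)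
  exact norm_whittV_integrand_le hs (by simp) (by simp) (hC w (mem_of_mem_nhds hV) s
    (le_of_lt hs) q hN)

lemma differentiableOn_whittV_arg {α μ : ℂ} (h : 0 < (α + μ).re) :
    DifferentiableOn ℂ (whittV α μ) Complex.slitPlane := by
  refine DifferentiableOn.const_mul (differentiableOn_integral_of_locally_dominated
    Complex.isOpen_slitPlane (fun w hw =>
      (measurable_whittV_integrand _ _ _).aestronglyMeasurable) ?_ ?_) _
  · refine (ae_restrict_iff' measurableSet_Ioi).mpr (Filter.Eventually.of_forall fun s hs => ?_)
    intro w hw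
    refine DifferentiableAt.differentiableWithinAt ?_
    refine DifferentiableAt.mul (DifferentiableAt.mul (by fun_prop) ?_) (by fun_prop)
    exact DifferentiableAt.cpow_const (by fun_prop) (one_add_mul_mem_slitPlane hw (le_of_lt hs))
  · intro w₀ hw₀
    obtain ⟨N, hN⟩ := exists_nat_ge ‖μ - α‖
    obtain ⟨V, hV, -, C, hC⟩ := exists_nhds_one_add_mul_cpow_bound hw₀ N
    refine ⟨V, hV, _, integrable_whittV_bound h h C N, ?_⟩
    refine (ae_restrict_iff' measurableSet_Ioi).mpr (Filter.Eventually.of_forall fun s hs => ?_)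
    exact fun w hw => norm_whittV_integrand_le hs (by simp) (by simp) (hC w hw s (le_of_lt hs) _ hN)

lemma differentiableOn_whittV_param (α : ℂ) {w : ℂ} (hw : w ∈ Complex.slitPlane) :
    DifferentiableOn ℂ (fun μ => whittV α μ w) {μ | 0 < (α + μ).re} := by
  have hopen : IsOpen {μ : ℂ | 0 < (α + μ).re} :=
    isOpen_lt continuous_const (Complex.continuous_re.comp (continuous_const.add continuous_id))
  refine DifferentiableOn.mul ?_ (differentiableOn_integral_of_locally_dominated hopen
    (fun μ hμ => (measurable_whittV_integrand _ _ _).aestronglyMeasurable) ?_ ?_)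
  · exact (Complex.differentiable_one_div_Gamma.comp
      (differentiable_id.const_add α)).differentiableOn
  · refine (ae_restrict_iff' measurableSet_Ioi).mpr (Filter.Eventually.of_forall fun s hs => ?_)
    have hs0 : (s : ℂ) ≠ 0 := by exact_mod_cast (ne_of_gt hs)
    refine Differentiable.differentiableOn ?_
    refine Differentiable.mul (Differentiable.mul ?_ ?_) (by fun_prop)
    · exact Differentiable.const_cpow (by fun_prop) (Or.inl hs0)
    · exact Differentiable.const_cpow (by fun_prop)
        (Or.inl (Complex.slitPlane_ne_zero (one_add_mul_mem_slitPlane hw (le_of_lt hs))))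
  · intro μ₀ hμ₀
    obtain ⟨N, hN⟩ := exists_nat_ge (‖μ₀‖ + 1 + ‖α‖)
    obtain ⟨V, hV, -, C, hC⟩ := exists_nhds_one_add_mul_cpow_bound hw N
    have hre : Continuous fun μ : ℂ => (α + μ).re :=
      Complex.continuous_re.comp (continuous_const.add continuous_id)
    have hμ₀' : 0 < (α + μ₀).re := hμ₀
    have e1 : ∀ᶠ μ in nhds μ₀, (α + μ₀).re / 2 < (α + μ).re :=
      hre.continuousAt.eventually_const_lt (by linarith)
    have e2 : ∀ᶠ μ in nhds μ₀, (α + μ).re < (α + μ₀).re + 1 :=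
      hre.continuousAt.eventually_lt_const (by linarith)
    have e3 : ∀ᶠ μ in nhds μ₀, ‖μ‖ < ‖μ₀‖ + 1 :=
      continuous_norm.continuousAt.eventually_lt_const (by linarith)
    -- Half of Re (α + μ₀) as lower exponent keeps the majorant integrable at 0 while leaving room
    -- for μ to move.
    refine ⟨_, e1.and (e2.and e3), _, integrable_whittV_bound (σ := (α + μ₀).re / 2)
      (τ := (α + μ₀).re + 1) (by linarith) (by linarith) C N, ?_⟩
    refine (ae_restrict_iff' measurableSet_Ioi).mpr (Filter.Eventually.of_forall fun s hs => ?_)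
    rintro μ ⟨h1, h2, h3⟩
    refine norm_whittV_integrand_le hs ?_ ?_ (hC w (mem_of_mem_nhds hV) s (le_of_lt hs) _ ?_)
    · rw [Complex.sub_re, Complex.one_re]; linarith
    · rw [Complex.sub_re, Complex.one_re]; linarith
    · refine (norm_sub_le _ _).trans ?_
      linarith

lemma tendsto_ofReal_nhdsNE (x : ℝ) :
    Filter.Tendsto (fun t : ℝ => (t : ℂ)) (nhdsWithin x {x}ᶜ) (nhdsWithin (x : ℂ) {(x : ℂ)}ᶜ) := by
  refine tendsto_nhdsWithin_of_tendsto_nhds_of_eventually_within _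
    (Complex.continuous_ofReal.continuousAt.tendsto.mono_left nhdsWithin_le_nhds) ?_
  filter_upwards [self_mem_nhdsWithin] with t ht
  simpa using ht

/-- The double integral that exhibits the symmetry of `V` in `μ`. -/
lemma whittV_eq_double_integral {α μ : ℂ} (h1 : 0 < (α - μ).re) {w : ℝ}
    (hw : 0 < w) :
    Complex.Gamma (α - μ) * ∫ s in Set.Ioi (0 : ℝ),
      (s : ℂ) ^ (α + μ - 1) * (1 + s * (w : ℂ)) ^ (μ - α) * Complex.exp (-(s : ℂ)) =
    ∫ s in Set.Ioi (0 : ℝ), ∫ r in Set.Ioi (0 : ℝ), Complex.exp (-((s * r * w : ℝ) : ℂ)) *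
      (((s : ℂ) ^ (α + μ - 1) * Complex.exp (-(s : ℂ))) *
        ((r : ℂ) ^ (α - μ - 1) * Complex.exp (-(r : ℂ)))) := by
  rw [← integral_const_mul]
  refine setIntegral_congr_fun measurableSet_Ioi fun s hs => ?_
  rw [Set.mem_Ioi] at hs
  have hp : 0 < 1 + s * w := by positivity
  -- The power of 1 + s w, multiplied by Γ(α - μ), is itself a Gamma integral, in the variable r.
  have h := Complex.integral_cpow_mul_exp_neg_mul_Ioi h1 hp
  have h2 : (1 + s * (w : ℂ)) ^ (μ - α) = (1 / ((1 + s * w : ℝ) : ℂ)) ^ (α - μ) := by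
    rw [one_div, Complex.inv_cpow _ _ (by
      rw [Complex.arg_ofReal_of_nonneg hp.le]; exact Real.pi_ne_zero.symm), ← Complex.cpow_neg,
      neg_sub]
    push_cast; rfl
  rw [h2, show Complex.Gamma (α - μ) * ((s : ℂ) ^ (α + μ - 1) *
    (1 / ((1 + s * w : ℝ) : ℂ)) ^ (α - μ) * Complex.exp (-(s : ℂ))) =
    ((s : ℂ) ^ (α + μ - 1) * Complex.exp (-(s : ℂ))) * ((1 / ((1 + s * w : ℝ) : ℂ)) ^ (α - μ) *
      Complex.Gamma (α - μ)) by ring, ← h, ← integral_const_mul]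
  refine setIntegral_congr_fun measurableSet_Ioi fun r _ => ?_
  rw [show -(((1 + s * w : ℝ) : ℂ) * r) = -((s * r * w : ℝ) : ℂ) + -(r : ℂ) by push_cast; ring,
    Complex.exp_add]
  ring

lemma integrableOn_cpow_mul_exp {p : ℂ} (hp : 0 < p.re) :
    IntegrableOn (fun s : ℝ => (s : ℂ) ^ (p - 1) * Complex.exp (-(s : ℂ))) (Set.Ioi 0) := by
  refine (Complex.GammaIntegral_convergent hp).congr_fun (fun s _ => ?_) measurableSet_Ioi
  push_cast
  ring

/-- In the double integral the kernel e^{-srw} is symmetric in s and r, so exchanging the order of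
integration exchanges μ and -μ. For w > 0 the kernel is at most 1, which justifies Fubini. -/
lemma whittV_symm_of_pos {α μ : ℂ} (h1 : 0 < (α - μ).re) (h2 : 0 < (α + μ).re) {w : ℝ}
    (hw : 0 < w) : whittV α μ w = whittV α (-μ) w := by
  have e1 := whittV_eq_double_integral h1 hw
  have e2 := whittV_eq_double_integral (α := α) (μ := -μ) (by simpa using h2) hw
  have g1 := Complex.Gamma_ne_zero_of_re_pos h1
  have g2 := Complex.Gamma_ne_zero_of_re_pos h2
  simp only [sub_neg_eq_add] at e2
  rw [whittV, whittV, ← sub_eq_add_neg, inv_mul_eq_div, inv_mul_eq_div, div_eq_div_iff g2 g1,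
    mul_comm _ (Complex.Gamma (α - μ)), mul_comm _ (Complex.Gamma (α + μ)), e1]
  simp only [← sub_eq_add_neg] at e2
  rw [e2, integral_integral_swap]
  · refine setIntegral_congr_fun measurableSet_Ioi fun s _ => ?_
    refine setIntegral_congr_fun measurableSet_Ioi fun r _ => ?_
    rw [mul_comm s r]
    ring
  · have hi := Integrable.mul_prod (integrableOn_cpow_mul_exp h2) (integrableOn_cpow_mul_exp h1)
    refine hi.bdd_mul (c := 1) ?_ ?_
    · refine Continuous.aestronglyMeasurable ?_
      fun_prop
    · rw [Measure.prod_restrict]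
      refine (ae_restrict_iff' (measurableSet_Ioi.prod measurableSet_Ioi)).mpr
        (Filter.Eventually.of_forall fun x hx => ?_)
      rw [norm_exp_neg_ofReal]
      refine Real.exp_le_one_iff.mpr ?_
      have := hx.1; have := hx.2
      simp only [Set.mem_Ioi] at *
      have : 0 < x.1 * x.2 * w := by positivity
      linarith

/-- The symmetry of `V` in `μ`. -/
lemma whittV_symm {α μ : ℂ} (h1 : 0 < (α - μ).re) (h2 : 0 < (α + μ).re) {w : ℂ}
    (hw : w ∈ Complex.slitPlane) : whittV α μ w = whittV α (-μ) w := by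
  refine AnalyticOnNhd.eqOn_of_preconnected_of_frequently_eq
    ((differentiableOn_whittV_arg h2).analyticOnNhd Complex.isOpen_slitPlane)
    ((differentiableOn_whittV_arg (by simpa [← sub_eq_add_neg] using h1)).analyticOnNhd
      Complex.isOpen_slitPlane)
    isPreconnected_slitPlane (z₀ := ((1 : ℝ) : ℂ)) (by simp) ?_ hw
  refine (tendsto_ofReal_nhdsNE 1).frequently (Filter.Eventually.frequently ?_)
  filter_upwards [nhdsWithin_le_nhds (isOpen_Ioi.mem_nhds (show (1 : ℝ) ∈ Set.Ioi 0 by simp))]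
    with t ht
  exact whittV_symm_of_pos h1 h2 ht

/-! ### The Möbius substitution -/

lemma ofReal_cpow_eq_exp {x : ℝ} (hx : 0 < x) (p : ℂ) :
    (x : ℂ) ^ p = Complex.exp ((Real.log x : ℂ) * p) := by
  rw [Complex.cpow_def_of_ne_zero (by exact_mod_cast hx.ne'), Complex.ofReal_log hx.le]

/-- The map fixes 0 and 1 and sends ∞ to 1 + 1/η, the zero of 1 + (1 - u) η. In the new variable
that branch point lies at infinity, and Euler's integral remains. -/
lemma moebius_image_Ioo {η : ℝ} (hη : 0 < η) :
    (fun s : ℝ => s * (1 + η) / (1 + η * s)) '' Set.Ioo 0 1 = Set.Ioo 0 1 := by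
  ext u
  constructor
  · rintro ⟨s, ⟨h0, h1⟩, rfl⟩
    have : 0 < 1 + η * s := by positivity
    refine ⟨by positivity, ?_⟩
    simp only
    rw [div_lt_one this]
    nlinarith
  · rintro ⟨h0, h1⟩
    have hp : 0 < 1 + η * (1 - u) := by nlinarith
    refine ⟨u / (1 + η * (1 - u)), ⟨by positivity, ?_⟩, ?_⟩
    · rw [div_lt_one hp]; nlinarith
    · have : 1 + η * (1 - u) + η * u ≠ 0 := by nlinarith
      have : 1 + η * (u / (1 + η * (1 - u))) ≠ 0 := by positivity
      simp only
      field_simp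
      ring

lemma moebius_injOn {η : ℝ} (hη : 0 < η) :
    Set.InjOn (fun s : ℝ => s * (1 + η) / (1 + η * s)) (Set.Ioo 0 1) := by
  intro s hs t ht h
  have h1 : 0 < 1 + η * s := by have := hs.1; positivity
  have h2 : 0 < 1 + η * t := by have := ht.1; positivity
  simp only at h
  rw [div_eq_div_iff h1.ne' h2.ne'] at h
  have : (1 + η) * (s - t) = 0 := by linear_combination h
  rcases mul_eq_zero.mp this with h' | h' <;> linarith

/-- A Möbius substitution that turns an integral with four branch points into Euler's integral. -/
lemma moebius_euler_integral_of_pos {a d β γ : ℂ} (hsum : a + d + β + γ = 0) {ξ η : ℝ} (hξ : 0 < ξ)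
    (hη : 0 < η) :
    ∫ u in (0 : ℝ)..1, (u : ℂ) ^ (a - 1) * (1 - (u : ℂ)) ^ (d - 1) *
        ((1 + u * (ξ : ℂ)) ^ β * (1 + (1 - u) * (η : ℂ)) ^ γ) =
      (1 + (η : ℂ)) ^ (a + γ) * ∫ s in (0 : ℝ)..1, (s : ℂ) ^ (a - 1) * (1 - (s : ℂ)) ^ (d - 1) *
        (1 + s * (ξ + η + ξ * η : ℂ)) ^ β := by
  rw [intervalIntegral.integral_of_le zero_le_one, intervalIntegral.integral_of_le zero_le_one,
    integral_Ioc_eq_integral_Ioo, integral_Ioc_eq_integral_Ioo]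
  conv_lhs => rw [← moebius_image_Ioo hη]
  rw [integral_image_eq_integral_abs_deriv_smul measurableSet_Ioo
    (f' := fun s => (1 + η) / (1 + η * s) ^ 2) (fun s hs => ?_) (moebius_injOn hη),
    ← integral_const_mul]
  · refine setIntegral_congr_fun measurableSet_Ioo fun s hs => ?_
    obtain ⟨h0, h1⟩ := hs
    have hP : 0 < 1 + η * s := by positivity
    have hs1 : 0 < 1 - s := by linarith
    have hη1 : 0 < 1 + η := by linarith
    have hZ : 0 < 1 + s * (ξ + η + ξ * η) := by positivity
    have hder : |(1 + η) / (1 + η * s) ^ 2| = (1 + η) / (1 + η * s) ^ 2 := abs_of_pos (by positivity)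
    have e1 : 1 - s * (1 + η) / (1 + η * s) = (1 - s) / (1 + η * s) := by field_simp; ring
    have e2 : 1 + s * (1 + η) / (1 + η * s) * ξ = (1 + s * (ξ + η + ξ * η)) / (1 + η * s) := by
      field_simp; ring
    have e3 : 1 + (1 - s * (1 + η) / (1 + η * s)) * η = (1 + η) / (1 + η * s) := by
      field_simp; ring
    have c1 : (1 : ℂ) - ((s * (1 + η) / (1 + η * s) : ℝ) : ℂ) = (((1 - s) / (1 + η * s) : ℝ) : ℂ) := by
      rw [← e1]; push_cast; rfl
    have c2 : (1 : ℂ) + ((s * (1 + η) / (1 + η * s) : ℝ) : ℂ) * ξ =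
        (((1 + s * (ξ + η + ξ * η)) / (1 + η * s) : ℝ) : ℂ) := by
      rw [← e2]; push_cast; rfl
    have c3 : (1 : ℂ) + (1 - ((s * (1 + η) / (1 + η * s) : ℝ) : ℂ)) * η =
        (((1 + η) / (1 + η * s) : ℝ) : ℂ) := by
      rw [← e3]; push_cast; rfl
    have c4 : (1 : ℂ) - s = ((1 - s : ℝ) : ℂ) := by push_cast; rfl
    have c5 : (1 : ℂ) + s * (ξ + η + ξ * η) = ((1 + s * (ξ + η + ξ * η) : ℝ) : ℂ) := by
      push_cast; rfl
    have c6 : (1 : ℂ) + η = ((1 + η : ℝ) : ℂ) := by push_cast; rfl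
    have c7 : (((1 + η) / (1 + η * s) ^ 2 : ℝ) : ℂ) =
        Complex.exp ((Real.log (1 + η) : ℂ) - 2 * (Real.log (1 + η * s) : ℂ)) := by
      have : (((1 + η) / (1 + η * s) ^ 2 : ℝ)) =
          Real.exp (Real.log (1 + η) - 2 * Real.log (1 + η * s)) := by
        rw [Real.exp_sub, Real.exp_log hη1, two_mul, Real.exp_add, Real.exp_log hP, sq]
      rw [this]; push_cast; rfl
    simp only [hder, Complex.real_smul]
    rw [c3, c1, c2, c4, c5, c6, c7, ofReal_cpow_eq_exp (div_pos (mul_pos h0 hη1) hP),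
      ofReal_cpow_eq_exp (div_pos hs1 hP), ofReal_cpow_eq_exp (div_pos hZ hP),
      ofReal_cpow_eq_exp (div_pos hη1 hP), ofReal_cpow_eq_exp hη1, ofReal_cpow_eq_exp h0,
      ofReal_cpow_eq_exp hs1, ofReal_cpow_eq_exp hZ, Real.log_div (by positivity) hP.ne',
      Real.log_div hs1.ne' hP.ne', Real.log_div hZ.ne' hP.ne', Real.log_div hη1.ne' hP.ne',
      Real.log_mul h0.ne' hη1.ne']
    simp only [← Complex.exp_add]
    congr 1
    push_cast
    -- The powers of 1 + η s, including the Jacobian's -2, add up to the exponent -(a + d + β + γ) =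
    -- 0.
    linear_combination (-(Real.log (1 + η * s) : ℂ)) * hsum
  · have hP : 1 + η * s ≠ 0 := by have := hs.1; positivity
    have : HasDerivAt (fun s : ℝ => s * (1 + η) / (1 + η * s))
        ((1 * (1 + η) * (1 + η * s) - s * (1 + η) * (η * 1)) / (1 + η * s) ^ 2) s :=
      ((hasDerivAt_id s).mul_const _).div (((hasDerivAt_id s).const_mul η).const_add 1) hP
    refine (this.congr_deriv ?_).hasDerivWithinAt
    congr 1
    ring

/-- Holomorphy of integrals against a Beta weight of functions that are continuous up to the end
points. -/
lemma differentiableOn_beta_integral {a d : ℂ} (ha : 0 < a.re) (hd : 0 < d.re) {U : Set ℂ}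
    (hU : IsOpen U) {k : ℂ → ℝ → ℂ} (hk : ContinuousOn (fun x : ℂ × ℝ => k x.1 x.2) (U ×ˢ Set.Icc 0 1))
    (hkd : ∀ u ∈ Set.Icc (0 : ℝ) 1, DifferentiableOn ℂ (fun φ => k φ u) U) :
    DifferentiableOn ℂ (fun φ => ∫ u in (0 : ℝ)..1, (u : ℂ) ^ (a - 1) * (1 - (u : ℂ)) ^ (d - 1) *
      k φ u) U := by
  simp only [intervalIntegral.integral_of_le zero_le_one]
  have hw : IntegrableOn (fun u : ℝ => (u : ℂ) ^ (a - 1) * (1 - (u : ℂ)) ^ (d - 1)) (Set.Ioc 0 1) :=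
    (intervalIntegrable_iff_integrableOn_Ioc_of_le zero_le_one).mp
      (betaIntegrand_intervalIntegrable ha hd)
  refine differentiableOn_integral_of_locally_dominated hU (fun φ hφ => ?_) ?_ ?_
  · refine hw.aestronglyMeasurable.mul (ContinuousOn.aestronglyMeasurable ?_ measurableSet_Ioc)
    exact hk.comp (by fun_prop : ContinuousOn (fun u : ℝ => (φ, u)) _)
      (fun u hu => ⟨hφ, hu.1.le, hu.2⟩)
  · refine (ae_restrict_iff' measurableSet_Ioc).mpr (Filter.Eventually.of_forall fun u hu => ?_)
    exact (hkd u ⟨hu.1.le, hu.2⟩).const_mul _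
  · intro φ₀ hφ₀
    obtain ⟨r, hr, hball⟩ := Metric.nhds_basis_closedBall.mem_iff.mp (hU.mem_nhds hφ₀)
    obtain ⟨C, hC⟩ := ((isCompact_closedBall φ₀ r).prod isCompact_Icc).exists_bound_of_continuousOn
      (hk.mono (Set.prod_mono_left hball))
    refine ⟨_, Metric.closedBall_mem_nhds φ₀ hr, _, hw.norm.mul_const C, ?_⟩
    refine (ae_restrict_iff' measurableSet_Ioc).mpr (Filter.Eventually.of_forall fun u hu => ?_)
    intro φ hφ
    rw [norm_mul]
    exact mul_le_mul_of_nonneg_left (hC (φ, u) ⟨hφ, hu.1.le, hu.2⟩) (norm_nonneg _)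

/-- The vertical strip `|Re φ| < π`. -/
def piStrip : Set ℂ := {φ | φ.re ∈ Set.Ioo (-Real.pi) Real.pi}

lemma isOpen_piStrip : IsOpen piStrip := isOpen_Ioo.preimage Complex.continuous_re

lemma isPreconnected_piStrip : IsPreconnected piStrip :=
  ((convex_Ioo (-Real.pi) Real.pi).linear_preimage Complex.reLm).isPreconnected

lemma ofReal_mul_exp_mem_slitPlane {ρ : ℝ} (hρ : 0 < ρ) {φ : ℂ} (hφ : φ ∈ piStrip) :
    ρ * Complex.exp (φ * Complex.I) ∈ Complex.slitPlane := by
  have e : ρ * Complex.exp (φ * Complex.I) =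
      ((ρ * Real.exp (-φ.im) : ℝ) : ℂ) * Complex.exp ((φ.re : ℂ) * Complex.I) := by
    conv_lhs => rw [← Complex.re_add_im φ]
    rw [add_mul, Complex.exp_add, mul_assoc (φ.im : ℂ), Complex.I_mul_I]
    push_cast
    ring_nf
  rw [Complex.mem_slitPlane_iff_arg, e]
  have hpos : 0 < ρ * Real.exp (-φ.im) := by positivity
  constructor
  · rw [Complex.arg_real_mul _ hpos, Complex.arg_exp_mul_I,
      (toIocMod_eq_self Real.two_pi_pos).mpr ⟨hφ.1, by linarith [hφ.2]⟩]
    exact hφ.2.ne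
  · exact mul_ne_zero (by exact_mod_cast hpos.ne') (Complex.exp_ne_zero _)

lemma neg_mem_piStrip {φ : ℂ} (hφ : φ ∈ piStrip) : -φ ∈ piStrip := by
  obtain ⟨h1, h2⟩ := hφ
  constructor <;> simp <;> linarith

/-- The imaginary part vanishes for s > 0 only if φ is imaginary, when the value is clearly
positive, or real, when it equals (1 - s) + s (1 - ρ)² + 2 s ρ (1 + cos φ) > 0. -/
lemma euler_base_mem_slitPlane {ρ s : ℝ} (hρ : 0 < ρ) (hs : s ∈ Set.Icc (0 : ℝ) 1) {φ : ℂ}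
    (hφ : φ ∈ piStrip) :
    1 + (s : ℂ) * (2 * ρ * Complex.cos φ + ρ ^ 2) ∈ Complex.slitPlane := by
  obtain ⟨h0, h1⟩ := hs
  rcases h0.eq_or_lt with rfl | h0
  · simp
  rw [Complex.mem_slitPlane_iff]
  have hcos : Complex.cos φ = ((Real.cos φ.re * Real.cosh φ.im : ℝ) : ℂ) -
      ((Real.sin φ.re * Real.sinh φ.im : ℝ) : ℂ) * Complex.I := by
    conv_lhs => rw [← Complex.re_add_im φ]
    rw [Complex.cos_add_mul_I]
    push_cast
    rfl
  have hre : (1 + (s : ℂ) * (2 * ρ * Complex.cos φ + ρ ^ 2)).re =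
      1 + s * (2 * ρ * (Real.cos φ.re * Real.cosh φ.im) + ρ ^ 2) := by
    rw [hcos, show (1 : ℂ) + (s : ℂ) * (2 * ρ * (((Real.cos φ.re * Real.cosh φ.im : ℝ) : ℂ) -
      ((Real.sin φ.re * Real.sinh φ.im : ℝ) : ℂ) * Complex.I) + ρ ^ 2) =
      ((1 + s * (2 * ρ * (Real.cos φ.re * Real.cosh φ.im) + ρ ^ 2) : ℝ) : ℂ) +
      ((-(s * (2 * ρ * (Real.sin φ.re * Real.sinh φ.im))) : ℝ) : ℂ) * Complex.I by push_cast; ring]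
    simp only [Complex.add_re, Complex.re_ofReal_mul, Complex.ofReal_re, Complex.I_re, mul_zero,
      add_zero]
  have him : (1 + (s : ℂ) * (2 * ρ * Complex.cos φ + ρ ^ 2)).im =
      -(s * (2 * ρ * (Real.sin φ.re * Real.sinh φ.im))) := by
    rw [hcos, show (1 : ℂ) + (s : ℂ) * (2 * ρ * (((Real.cos φ.re * Real.cosh φ.im : ℝ) : ℂ) -
      ((Real.sin φ.re * Real.sinh φ.im : ℝ) : ℂ) * Complex.I) + ρ ^ 2) =
      ((1 + s * (2 * ρ * (Real.cos φ.re * Real.cosh φ.im) + ρ ^ 2) : ℝ) : ℂ) +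
      ((-(s * (2 * ρ * (Real.sin φ.re * Real.sinh φ.im))) : ℝ) : ℂ) * Complex.I by push_cast; ring]
    simp only [Complex.add_im, Complex.im_ofReal_mul, Complex.ofReal_im, Complex.I_im, mul_one,
      zero_add]
  rw [hre, him]
  by_cases h : Real.sin φ.re * Real.sinh φ.im = 0
  · left
    rcases mul_eq_zero.mp h with h | h
    · have : φ.re = 0 := (Real.sin_eq_zero_iff_of_lt_of_lt hφ.1 hφ.2).mp h
      rw [this, Real.cos_zero]
      have := Real.cosh_pos φ.im
      positivity
    · have : φ.im = 0 := Real.sinh_eq_zero.mp h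
      rw [this, Real.cosh_zero]
      have hc : -1 < Real.cos φ.re := by
        rw [← Real.cos_pi, ← Real.cos_abs φ.re]
        exact Real.cos_lt_cos_of_nonneg_of_le_pi (abs_nonneg _) le_rfl (abs_lt.mpr hφ)
      have h2 : 0 < s * ρ * (1 + Real.cos φ.re) := by
        have : 0 < 1 + Real.cos φ.re := by linarith
        positivity
      nlinarith [mul_nonneg h0.le (sq_nonneg (1 - ρ))]
  · right
    have := mul_pos h0 hρ
    intro h'
    apply h
    have h3 : (s * ρ) * (2 * (Real.sin φ.re * Real.sinh φ.im)) = 0 := by linarith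
    rcases mul_eq_zero.mp h3 with h4 | h4
    · linarith
    · linarith

/-- Passes from positive to conjugate branch points by the identity theorem, with ξ = ρ e^{iφ} and η
= ρ e^{-iφ}. For imaginary φ both are positive and `moebius_euler_integral_of_pos` applies; for real
φ they are conjugate. Throughout, ξ + η + ξη = 2ρ cos φ + ρ². -/
lemma moebius_euler_integral_strip {a d β γ : ℂ} (ha : 0 < a.re) (hd : 0 < d.re)
    (hsum : a + d + β + γ = 0) {ρ : ℝ} (hρ : 0 < ρ) :
    Set.EqOn (fun φ : ℂ => ∫ u in (0 : ℝ)..1, (u : ℂ) ^ (a - 1) * (1 - (u : ℂ)) ^ (d - 1) *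
        ((1 + u * (ρ * Complex.exp (φ * Complex.I))) ^ β *
          (1 + (1 - u) * (ρ * Complex.exp (-φ * Complex.I))) ^ γ))
      (fun φ : ℂ => (1 + ρ * Complex.exp (-φ * Complex.I)) ^ (a + γ) * ∫ s in (0 : ℝ)..1,
        (s : ℂ) ^ (a - 1) * (1 - (s : ℂ)) ^ (d - 1) *
          (1 + s * (2 * ρ * Complex.cos φ + ρ ^ 2)) ^ β) piStrip := by
  have m1 : ∀ φ ∈ piStrip, ∀ u ∈ Set.Icc (0 : ℝ) 1,
      1 + (u : ℂ) * (ρ * Complex.exp (φ * Complex.I)) ∈ Complex.slitPlane := fun φ hφ u hu =>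
    one_add_mul_mem_slitPlane (ofReal_mul_exp_mem_slitPlane hρ hφ) hu.1
  have m2 : ∀ φ ∈ piStrip, ∀ u ∈ Set.Icc (0 : ℝ) 1,
      1 + (1 - (u : ℂ)) * (ρ * Complex.exp (-φ * Complex.I)) ∈ Complex.slitPlane :=
    fun φ hφ u hu => by
      have := one_add_mul_mem_slitPlane (s := 1 - u)
        (ofReal_mul_exp_mem_slitPlane hρ (neg_mem_piStrip hφ)) (by linarith [hu.2])
      push_cast at this
      exact this
  have m3 : ∀ φ ∈ piStrip, 1 + ρ * Complex.exp (-φ * Complex.I) ∈ Complex.slitPlane := by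
    intro φ hφ
    have := m2 φ hφ 0 (by simp)
    simpa using this
  refine AnalyticOnNhd.eqOn_of_preconnected_of_frequently_eq (z₀ := ((0 : ℝ) : ℂ) * Complex.I)
    (DifferentiableOn.analyticOnNhd ?_ isOpen_piStrip)
    (DifferentiableOn.analyticOnNhd ?_ isOpen_piStrip) isPreconnected_piStrip
    (by simp [piStrip, Real.pi_pos]) ?_
  · refine differentiableOn_beta_integral ha hd isOpen_piStrip
      (k := fun φ u => (1 + u * (ρ * Complex.exp (φ * Complex.I))) ^ β *
          (1 + (1 - u) * (ρ * Complex.exp (-φ * Complex.I))) ^ γ) ?_ ?_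
    · refine ContinuousOn.mul ?_ ?_
      · exact ContinuousOn.cpow_const (by fun_prop) fun x hx => m1 x.1 hx.1 x.2 hx.2
      · exact ContinuousOn.cpow_const (by fun_prop) fun x hx => m2 x.1 hx.1 x.2 hx.2
    · intro u hu
      refine DifferentiableOn.mul ?_ ?_
      · exact DifferentiableOn.cpow_const (by fun_prop) fun x hx => m1 x hx u hu
      · exact DifferentiableOn.cpow_const (by fun_prop) fun x hx => m2 x hx u hu
  · refine DifferentiableOn.mul ?_ (differentiableOn_beta_integral ha hd isOpen_piStrip
      (k := fun φ s => (1 + s * (2 * ρ * Complex.cos φ + ρ ^ 2)) ^ β) ?_ ?_)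
    · exact DifferentiableOn.cpow_const (by fun_prop) m3
    · exact ContinuousOn.cpow_const (by fun_prop)
        fun x hx => euler_base_mem_slitPlane hρ hx.2 hx.1
    · intro u hu
      exact DifferentiableOn.cpow_const (by fun_prop)
        fun x hx => euler_base_mem_slitPlane hρ hu hx
  · have hlim : Filter.Tendsto (fun t : ℝ => (t : ℂ) * Complex.I) (nhdsWithin 0 {0}ᶜ)
        (nhdsWithin (((0 : ℝ) : ℂ) * Complex.I) {((0 : ℝ) : ℂ) * Complex.I}ᶜ) := by
      refine tendsto_nhdsWithin_of_tendsto_nhds_of_eventually_within _ ?_ ?_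
      · have : Continuous fun t : ℝ => (t : ℂ) * Complex.I := by fun_prop
        exact this.continuousAt.tendsto.mono_left nhdsWithin_le_nhds
      · filter_upwards [self_mem_nhdsWithin] with t ht
        simpa using ht
    refine hlim.frequently (Filter.Eventually.frequently (Filter.Eventually.of_forall fun t => ?_))
    have h := moebius_euler_integral_of_pos hsum (ξ := ρ * Real.exp (-t)) (η := ρ * Real.exp t)
      (by positivity) (by positivity)
    have e1 : (ρ : ℂ) * Complex.exp ((t : ℂ) * Complex.I * Complex.I) =
        ((ρ * Real.exp (-t) : ℝ) : ℂ) := by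
      rw [mul_assoc (t : ℂ), Complex.I_mul_I]; push_cast; ring_nf
    have e2 : (ρ : ℂ) * Complex.exp (-((t : ℂ) * Complex.I) * Complex.I) =
        ((ρ * Real.exp t : ℝ) : ℂ) := by
      rw [neg_mul, mul_assoc (t : ℂ), Complex.I_mul_I]; push_cast; ring_nf
    have e3 : (2 * (ρ : ℂ) * Complex.cos ((t : ℂ) * Complex.I) + ρ ^ 2) =
        ((ρ * Real.exp (-t) : ℝ) : ℂ) + ((ρ * Real.exp t : ℝ) : ℂ) +
          ((ρ * Real.exp (-t) : ℝ) : ℂ) * ((ρ * Real.exp t : ℝ) : ℂ) := by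
      have h5 : Complex.exp (-(t : ℂ)) * Complex.exp t = 1 := by
        rw [← Complex.exp_add]; simp
      rw [Complex.cos_mul_I, Complex.cosh]
      push_cast
      linear_combination (-(ρ : ℂ) ^ 2) * h5
    simp only [e1, e2, e3]
    exact h

/-- The Möbius substitution for conjugate branch points. -/
lemma moebius_euler_integral {a d β γ : ℂ} (ha : 0 < a.re) (hd : 0 < d.re)
    (hsum : a + d + β + γ = 0) {ξ : ℂ} (hξ : ξ ∈ Complex.slitPlane) :
    ∫ u in (0 : ℝ)..1, (u : ℂ) ^ (a - 1) * (1 - (u : ℂ)) ^ (d - 1) *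
        ((1 + u * ξ) ^ β * (1 + (1 - u) * (starRingEnd ℂ ξ)) ^ γ) =
      (1 + starRingEnd ℂ ξ) ^ (a + γ) * ∫ s in (0 : ℝ)..1, (s : ℂ) ^ (a - 1) *
        (1 - (s : ℂ)) ^ (d - 1) * (1 - s * ((1 - ‖1 + ξ‖ ^ 2 : ℝ) : ℂ)) ^ β := by
  have hρ : 0 < ‖ξ‖ := norm_pos_iff.mpr (Complex.slitPlane_ne_zero hξ)
  have hφ : (ξ.arg : ℂ) ∈ piStrip :=
    ⟨Complex.neg_pi_lt_arg ξ, lt_of_le_of_ne (Complex.arg_le_pi ξ)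
      (Complex.mem_slitPlane_iff_arg.mp hξ).1⟩
  have h := moebius_euler_integral_strip ha hd hsum hρ hφ
  have e1 : (‖ξ‖ : ℂ) * Complex.exp ((ξ.arg : ℂ) * Complex.I) = ξ := Complex.norm_mul_exp_arg_mul_I ξ
  have e2 : (‖ξ‖ : ℂ) * Complex.exp (-(ξ.arg : ℂ) * Complex.I) = starRingEnd ℂ ξ := by
    conv_rhs => rw [← e1]
    rw [map_mul, ← Complex.exp_conj, map_mul, Complex.conj_ofReal, Complex.conj_ofReal,
      Complex.conj_I]
    ring_nf
  have e3 : (2 * (‖ξ‖ : ℂ) * Complex.cos ξ.arg + (‖ξ‖ : ℂ) ^ 2) =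
      -((1 - ‖1 + ξ‖ ^ 2 : ℝ) : ℂ) := by
    have h1 : ‖ξ‖ * Real.cos ξ.arg = ξ.re := Complex.norm_mul_cos_arg ξ
    have h2 : ‖1 + ξ‖ ^ 2 = 1 + 2 * ξ.re + ‖ξ‖ ^ 2 := by
      rw [Complex.sq_norm, Complex.sq_norm, Complex.normSq_apply, Complex.normSq_apply]
      simp
      ring
    rw [h2, ← h1]
    push_cast
    ring
  simp only [e1, e2, e3] at h
  rw [h]
  simp only [mul_neg, sub_eq_add_neg]

lemma conj_mem_slitPlane {w : ℂ} (hw : w ∈ Complex.slitPlane) :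
    starRingEnd ℂ w ∈ Complex.slitPlane := by
  rw [Complex.mem_slitPlane_iff] at hw ⊢
  simpa using hw

lemma one_sub_norm_sq_lt_one {w : ℂ} (hw : w ∈ Complex.slitPlane) {x : ℝ} (hx : 0 ≤ x) :
    1 - ‖1 + x * w‖ ^ 2 < 1 := by
  have := norm_pos_iff.mpr (Complex.slitPlane_ne_zero (one_add_mul_mem_slitPlane hw hx))
  have : 0 < ‖1 + x * w‖ ^ 2 := by positivity
  linarith

/-! ### The product formula -/

/-- The Laplace density, without the exponential, of the product `V(α, μ, w) V(ᾱ, μ, w̄)`. -/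
noncomputable def productDensity (α μ w : ℂ) (x : ℝ) : ℂ :=
  (x : ℂ) ^ (((2 * α.re : ℝ) : ℂ) - 1) * (1 + x * starRingEnd ℂ w) ^ (α - starRingEnd ℂ α) *
    hypReal (α + μ) (α - μ) (2 * α.re) (1 - ‖1 + x * w‖ ^ 2)

lemma add_conj_eq (α : ℂ) : α + starRingEnd ℂ α = ((2 * α.re : ℝ) : ℂ) := by
  rw [Complex.add_conj]

/-- The convolution of the two densities is computed by Euler's integral. -/
lemma convolution_whittV_integrand {α μ w : ℂ} (h1 : 0 < (α - μ).re) (h2 : 0 < (α + μ).re)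
    (hw : w ∈ Complex.slitPlane) {x : ℝ} (hx : 0 < x) :
    ∫ t in (0 : ℝ)..x, ((t : ℂ) ^ (α - μ - 1) * (1 + t * w) ^ (-μ - α) * Complex.exp (-(t : ℂ))) *
      (((x - t : ℝ) : ℂ) ^ (starRingEnd ℂ α + μ - 1) *
        (1 + ((x - t : ℝ) : ℂ) * starRingEnd ℂ w) ^ (μ - starRingEnd ℂ α) *
          Complex.exp (-((x - t : ℝ) : ℂ))) =
    Complex.betaIntegral (α - μ) (starRingEnd ℂ α + μ) *
      (productDensity α μ w x * Complex.exp (-(x : ℂ))) := by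
  have hd : 0 < (starRingEnd ℂ α + μ).re := by simpa using h2
  have hc := add_conj_eq α
  have hx0 : (x : ℂ) ≠ 0 := by exact_mod_cast hx.ne'
  have hξ : (x : ℂ) * w ∈ Complex.slitPlane := by
    rw [Complex.mem_slitPlane_iff] at hw ⊢
    simpa [hx, hx.ne'] using hw
  -- The substitution t = x u moves the convolution to the unit interval.
  have hscale := intervalIntegral.integral_comp_mul_left (a := 0) (b := 1)
    (fun t : ℝ => ((t : ℂ) ^ (α - μ - 1) * (1 + t * w) ^ (-μ - α) * Complex.exp (-(t : ℂ))) *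
      (((x - t : ℝ) : ℂ) ^ (starRingEnd ℂ α + μ - 1) *
        (1 + ((x - t : ℝ) : ℂ) * starRingEnd ℂ w) ^ (μ - starRingEnd ℂ α) *
          Complex.exp (-((x - t : ℝ) : ℂ)))) hx.ne'
  rw [mul_zero, mul_one, eq_inv_smul_iff₀ hx.ne'] at hscale
  rw [← hscale]
  have hpt : ∀ u ∈ Set.uIcc (0 : ℝ) 1,
      (((x * u : ℝ) : ℂ) ^ (α - μ - 1) * (1 + ((x * u : ℝ) : ℂ) * w) ^ (-μ - α) *
        Complex.exp (-((x * u : ℝ) : ℂ))) *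
      (((x - x * u : ℝ) : ℂ) ^ (starRingEnd ℂ α + μ - 1) *
        (1 + ((x - x * u : ℝ) : ℂ) * starRingEnd ℂ w) ^ (μ - starRingEnd ℂ α) *
          Complex.exp (-((x - x * u : ℝ) : ℂ))) =
      ((x : ℂ) ^ (((2 * α.re : ℝ) : ℂ) - 2) * Complex.exp (-(x : ℂ))) *
      ((u : ℂ) ^ (α - μ - 1) * (1 - (u : ℂ)) ^ (starRingEnd ℂ α + μ - 1) *
        ((1 + u * (x * w)) ^ (-μ - α) *
          (1 + (1 - u) * (starRingEnd ℂ (x * w))) ^ (μ - starRingEnd ℂ α))) := by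
    intro u hu
    rw [Set.uIcc_of_le zero_le_one] at hu
    have e1 : ((x - x * u : ℝ) : ℂ) = (x : ℂ) * ((1 - u : ℝ) : ℂ) := by push_cast; ring
    have e2 : ((x * u : ℝ) : ℂ) = (x : ℂ) * (u : ℂ) := by push_cast; ring
    rw [e1, e2, Complex.mul_cpow_ofReal_nonneg hx.le hu.1,
      Complex.mul_cpow_ofReal_nonneg hx.le (by linarith [hu.2]),
      show ((2 * α.re : ℝ) : ℂ) - 2 = (α - μ - 1) + (starRingEnd ℂ α + μ - 1) by rw [← hc]; ring,
      Complex.cpow_add _ _ hx0,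
      show -(x : ℂ) = -(x * u) + -(x * ((1 - u : ℝ) : ℂ)) by push_cast; ring, Complex.exp_add,
      map_mul, Complex.conj_ofReal]
    push_cast
    rw [show (1 : ℂ) + x * u * w = 1 + u * (x * w) by ring,
      show (1 : ℂ) + x * (1 - u) * starRingEnd ℂ w = 1 + (1 - u) * (x * starRingEnd ℂ w) by ring]
    ring
  -- The exponents α - μ, ᾱ + μ, -μ - α and μ - ᾱ sum to 0, as the Möbius substitution requires.
  rw [intervalIntegral.integral_congr hpt, intervalIntegral.integral_const_mul,
    moebius_euler_integral h1 hd (by ring) hξ]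
  have hz : 1 - ‖1 + x * w‖ ^ 2 < 1 := one_sub_norm_sq_lt_one hw hx.le
  have hE := euler_integral_hypReal (α + μ) (b := α - μ) (c := 2 * α.re) h1
    (by simp at h2 ⊢; linarith) hz
  rw [show ((2 * α.re : ℝ) : ℂ) - (α - μ) - 1 = starRingEnd ℂ α + μ - 1 by rw [← hc]; ring,
    show ((2 * α.re : ℝ) : ℂ) - (α - μ) = starRingEnd ℂ α + μ by rw [← hc]; ring] at hE
  rw [show -μ - α = -(α + μ) by ring, hE, productDensity, Complex.real_smul,
    show ((2 * α.re : ℝ) : ℂ) - 1 = 1 + (((2 * α.re : ℝ) : ℂ) - 2) by ring,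
    Complex.cpow_add _ _ hx0, Complex.cpow_one,
    show α - μ + (μ - starRingEnd ℂ α) = α - starRingEnd ℂ α by ring, map_mul, Complex.conj_ofReal]
  ring

/-- A product of Laplace integrals is the integral of the convolution. The symmetry in μ is used on
the first factor only: with both factors at μ the four exponents would sum to 4μ instead of 0. The
Beta factor cancels the two Gamma normalisations and leaves 1/Γ(2 Re α). -/
lemma whittV_mul_conj_of_strip {α μ w : ℂ} (h1 : 0 < (α - μ).re) (h2 : 0 < (α + μ).re)
    (hw : w ∈ Complex.slitPlane) :
    whittV α μ w * whittV (starRingEnd ℂ α) μ (starRingEnd ℂ w) =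
      (Complex.Gamma ((2 * α.re : ℝ) : ℂ))⁻¹ *
        ∫ x in Set.Ioi (0 : ℝ), productDensity α μ w x * Complex.exp (-(x : ℂ)) := by
  have hd : 0 < (starRingEnd ℂ α + μ).re := by simpa using h2
  have hconv := integral_posConvolution (μ := volume) (ν := volume)
    (f := fun s : ℝ => (s : ℂ) ^ (α - μ - 1) * (1 + s * w) ^ (-μ - α) * Complex.exp (-(s : ℂ)))
    (g := fun s : ℝ => (s : ℂ) ^ (starRingEnd ℂ α + μ - 1) *
      (1 + s * starRingEnd ℂ w) ^ (μ - starRingEnd ℂ α) * Complex.exp (-(s : ℂ)))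
    (integrableOn_whittV_integrand h1 _ hw)
    (integrableOn_whittV_integrand hd _ (conj_mem_slitPlane hw)) (ContinuousLinearMap.mul ℝ ℂ)
  simp only [ContinuousLinearMap.mul_apply'] at hconv
  rw [setIntegral_congr_fun measurableSet_Ioi
    (fun x hx => convolution_whittV_integrand h1 h2 hw hx), integral_const_mul] at hconv
  rw [whittV_symm h1 h2 hw, whittV, whittV, ← sub_eq_add_neg, mul_mul_mul_comm, ← hconv,
    Complex.betaIntegral_eq_Gamma_mul_div _ _ h1 hd,
    show α - μ + (starRingEnd ℂ α + μ) = ((2 * α.re : ℝ) : ℂ) by rw [← add_conj_eq]; ring]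
  have g1 := Complex.Gamma_ne_zero_of_re_pos h1
  have g2 := Complex.Gamma_ne_zero_of_re_pos hd
  field_simp

lemma continuousOn_hypReal_comp (a b : ℂ) {c : ℝ} (hc : 0 < c) {w : ℂ}
    (hw : w ∈ Complex.slitPlane) :
    ContinuousOn (fun x : ℝ => hypReal a b c (1 - ‖1 + x * w‖ ^ 2)) (Set.Ici 0) :=
  (analyticOnNhd_hypReal a b hc).continuousOn.comp (by fun_prop)
    fun _ hx => one_sub_norm_sq_lt_one hw hx

lemma aestronglyMeasurable_productDensity {α : ℂ} (hα : 0 < α.re) (μ : ℂ) {w : ℂ}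
    (hw : w ∈ Complex.slitPlane) :
    AEStronglyMeasurable (productDensity α μ w) (volume.restrict (Set.Ioi 0)) := by
  refine AEStronglyMeasurable.mul (Measurable.aestronglyMeasurable (by fun_prop)) ?_
  exact ((continuousOn_hypReal_comp _ _ (by linarith) hw).mono Set.Ioi_subset_Ici_self)
    |>.aestronglyMeasurable measurableSet_Ioi

/-- A bound of the density of polynomial growth, locally uniform in `μ`. -/
lemma exists_nhds_productDensity_bound {α : ℂ} (hα : 0 < α.re) (μ₀ : ℂ) {w : ℂ}
    (hw : w ∈ Complex.slitPlane) :
    ∃ V ∈ nhds μ₀, ∃ C : ℝ, ∃ N : ℕ, ∀ μ ∈ V, ∀ x : ℝ, 0 < x →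
      ‖productDensity α μ w x‖ ≤ C * (x ^ (2 * α.re - 1) * (1 + x) ^ N) := by
  have hc : 0 < 2 * α.re := by linarith
  obtain ⟨A, hA⟩ := exists_nat_ge (‖α‖ + (‖μ₀‖ + 1))
  obtain ⟨D, hD1, hD2⟩ := exists_hypCoeff_exponent hc A (A + 2 * α.re)
  obtain ⟨N, hN⟩ := exists_nat_ge ‖α - starRingEnd ℂ α‖
  obtain ⟨V₁, hV₁, -, C₁, hC₁⟩ := exists_nhds_one_add_mul_cpow_bound (conj_mem_slitPlane hw) N
  obtain ⟨V₂, hV₂, -, M, hM, hb⟩ := exists_nhds_one_add_mul_bounds hw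
  -- `K` serves both for the power D + 1 of |1 + xw|⁻² and for the power A + D + 1 of |1 + xw|².
  set K := A + D + 1 with hK
  refine ⟨Metric.ball μ₀ 1, Metric.ball_mem_nhds _ one_pos, C₁ * (2 * (M ^ 2) ^ K), N + 2 * K,
    fun μ hμ x hx => ?_⟩
  have hμn : ‖μ‖ ≤ ‖μ₀‖ + 1 := by
    rw [Metric.mem_ball, dist_eq_norm] at hμ
    linarith [norm_le_norm_add_norm_sub' μ μ₀]
  have ha : ‖α + μ‖ ≤ A := (norm_add_le _ _).trans (by linarith)
  have hb' : ‖α - μ‖ ≤ A := (norm_sub_le _ _).trans (by linarith)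
  obtain ⟨h1, h2⟩ := hb w (mem_of_mem_nhds hV₂) x hx.le
  have hr : 0 < ‖1 + x * w‖ :=
    norm_pos_iff.mpr (Complex.slitPlane_ne_zero (one_add_mul_mem_slitPlane hw hx.le))
  have hH := norm_hypReal_le hc ha hb' hD1 hD2 (one_sub_norm_sq_lt_one hw hx.le)
  rw [sub_sub_cancel] at hH
  have hMx : 1 ≤ M * (1 + x) := one_le_mul_of_one_le_of_one_le hM (by linarith)
  have hH2 : ‖hypReal (α + μ) (α - μ) (2 * α.re) (1 - ‖1 + x * w‖ ^ 2)‖ ≤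
      2 * (M ^ 2) ^ K * (1 + x) ^ (2 * K) := by
    have b1 : ((‖1 + x * w‖ ^ 2)⁻¹) ^ (D + 1) ≤ ((M * (1 + x)) ^ 2) ^ K := by
      calc ((‖1 + x * w‖ ^ 2)⁻¹) ^ (D + 1) = (‖1 + x * w‖⁻¹ ^ 2) ^ (D + 1) := by rw [inv_pow ‖1 + x * w‖ 2]
        _ ≤ ((M * (1 + x)) ^ 2) ^ (D + 1) := by
            gcongr
            exact h2.trans (le_mul_of_one_le_right (by linarith) (by linarith))
        _ ≤ _ := pow_le_pow_right₀ (one_le_pow₀ hMx) (by omega)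
    have b2 : (‖1 + x * w‖ ^ 2) ^ ((A : ℝ) + D + 1) ≤ ((M * (1 + x)) ^ 2) ^ K := by
      rw [show (A : ℝ) + D + 1 = (K : ℕ) by rw [hK]; push_cast; ring, Real.rpow_natCast]
      gcongr
    calc _ ≤ ((M * (1 + x)) ^ 2) ^ K + ((M * (1 + x)) ^ 2) ^ K := hH.trans (add_le_add b1 b2)
      _ = _ := by rw [mul_pow, mul_pow, ← pow_mul (1 + x)]; ring
  have hC := hC₁ _ (mem_of_mem_nhds hV₁) x hx.le _ hN
  rw [productDensity, norm_mul, norm_mul, Complex.norm_cpow_eq_rpow_re_of_pos hx]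
  have hre : ((((2 * α.re : ℝ) : ℂ) - 1)).re = 2 * α.re - 1 := by simp
  rw [hre]
  calc _ ≤ x ^ (2 * α.re - 1) * (C₁ * (1 + x) ^ N) * (2 * (M ^ 2) ^ K * (1 + x) ^ (2 * K)) := by
        gcongr
        exact mul_nonneg (by positivity) ((norm_nonneg _).trans hC)
    _ = _ := by rw [pow_add]; ring

/-- The product formula for Whittaker functions with conjugate arguments. -/
lemma whittV_mul_conj {α μ w : ℂ} (hα : 0 < α.re) (h : 0 < (α + μ).re)
    (hw : w ∈ Complex.slitPlane) :
    whittV α μ w * whittV (starRingEnd ℂ α) μ (starRingEnd ℂ w) =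
      (Complex.Gamma ((2 * α.re : ℝ) : ℂ))⁻¹ *
        ∫ x in Set.Ioi (0 : ℝ), productDensity α μ w x * Complex.exp (-(x : ℂ)) := by
  have hc : 0 < 2 * α.re := by linarith
  set U : Set ℂ := {μ | 0 < (α + μ).re} with hU
  have hre : Continuous fun μ : ℂ => (α + μ).re :=
    Complex.continuous_re.comp (continuous_const.add continuous_id)
  have hre' : Continuous fun μ : ℂ => (α - μ).re :=
    Complex.continuous_re.comp (continuous_const.sub continuous_id)
  have hUo : IsOpen U := isOpen_lt continuous_const hre
  have hUc : IsPreconnected U := by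
    have : U = {μ : ℂ | -α.re < μ.re} := by
      ext μ; simp only [hU, Set.mem_ofPred_eq, Complex.add_re]
      constructor <;> intro h <;> linarith
    rw [this]
    exact (convex_halfSpace_re_gt _).isPreconnected
  have hl : DifferentiableOn ℂ (fun μ => whittV α μ w *
      whittV (starRingEnd ℂ α) μ (starRingEnd ℂ w)) U := by
    refine (differentiableOn_whittV_param α hw).mul
      ((differentiableOn_whittV_param _ (conj_mem_slitPlane hw)).mono fun μ hμ => ?_)
    simpa [hU] using hμ
  have hr : DifferentiableOn ℂ (fun μ => (Complex.Gamma ((2 * α.re : ℝ) : ℂ))⁻¹ *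
      ∫ x in Set.Ioi (0 : ℝ), productDensity α μ w x * Complex.exp (-(x : ℂ))) U := by
    refine DifferentiableOn.const_mul (differentiableOn_integral_of_locally_dominated hUo
      (fun μ _ => (aestronglyMeasurable_productDensity hα μ hw).mul
        (Measurable.aestronglyMeasurable (by fun_prop))) ?_ ?_) _
    · refine (ae_restrict_iff' measurableSet_Ioi).mpr (Filter.Eventually.of_forall fun x hx => ?_)
      refine Differentiable.differentiableOn ?_
      refine Differentiable.mul_const (Differentiable.const_mul ?_ _) _
      exact differentiable_hypReal_param (by fun_prop) (by fun_prop) hc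
        (one_sub_norm_sq_lt_one hw (le_of_lt hx))
    · intro μ₀ _
      obtain ⟨V, hV, C, N, hb⟩ := exists_nhds_productDensity_bound hα μ₀ hw
      refine ⟨V, hV, _, (integrableOn_rpow_mul_one_add_pow_mul_exp hc N).const_mul C, ?_⟩
      refine (ae_restrict_iff' measurableSet_Ioi).mpr (Filter.Eventually.of_forall fun x hx => ?_)
      intro μ hμ
      rw [Pi.mul_apply, norm_mul, norm_exp_neg_ofReal]
      calc _ ≤ (C * (x ^ (2 * α.re - 1) * (1 + x) ^ N)) * Real.exp (-x) :=
            mul_le_mul_of_nonneg_right (hb μ hμ x hx) (Real.exp_pos _).le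
        _ = _ := by ring
  -- Near μ = 0 the strip condition |Re μ| < Re α holds; the identity theorem carries the formula to
  -- the whole half-plane.
  refine (hl.analyticOnNhd hUo).eqOn_of_preconnected_of_eventuallyEq (hr.analyticOnNhd hUo) hUc
    (z₀ := 0) (by simpa [hU] using hα) ?_ h
  have e1 : ∀ᶠ μ in nhds (0 : ℂ), 0 < (α + μ).re :=
    hre.continuousAt.eventually_const_lt (by simpa using hα)
  have e2 : ∀ᶠ μ in nhds (0 : ℂ), 0 < (α - μ).re :=
    hre'.continuousAt.eventually_const_lt (by simpa using hα)
  filter_upwards [e1, e2] with μ h1 h2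
  exact whittV_mul_conj_of_strip h2 h1 hw

/-! ### Laplace transforms and complete monotonicity -/

lemma integrableOn_rpow_mul_one_add_pow_mul_exp_mul {σ : ℝ} (hσ : 0 < σ) (N : ℕ) {t : ℝ}
    (ht : 0 < t) :
    IntegrableOn (fun s : ℝ => s ^ (σ - 1) * (1 + s) ^ N * Real.exp (-t * s)) (Set.Ioi 0) := by
  have h : ∀ i ∈ Finset.range (N + 1), IntegrableOn (fun s : ℝ => (N.choose i : ℝ) *
      (s ^ ((σ + i) - 1) * Real.exp (-t * s ^ (1 : ℝ)))) (Set.Ioi 0) := fun i _ =>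
    (integrableOn_rpow_mul_exp_neg_mul_rpow
      (by linarith [(Nat.cast_nonneg i : (0 : ℝ) ≤ i)]) one_pos ht).const_mul _
  refine IntegrableOn.congr_fun (integrable_finsetSum _ h) (fun s hs => ?_) measurableSet_Ioi
  rw [Set.mem_Ioi] at hs
  simp only [add_comm (1 : ℝ) s, add_pow, one_pow, mul_one, Finset.mul_sum, Finset.sum_mul,
    Real.rpow_one]
  refine Finset.sum_congr rfl fun i _ => ?_
  rw [show σ + i - 1 = (σ - 1) + (i : ℝ) by ring, Real.rpow_add hs, Real.rpow_natCast]
  ring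

section LaplaceTransform

variable {ρ : ℝ → ℝ} {σ C : ℝ} {N : ℕ}

lemma norm_laplace_integrand_le (hρ : ∀ v, 0 < v → |ρ v| ≤ C * (v ^ (σ - 1) * (1 + v) ^ N))
    (n : ℕ) (t : ℝ) {v : ℝ} (hv : 0 < v) :
    ‖v ^ n * ρ v * Real.exp (-t * v)‖ ≤
      C * (v ^ (σ - 1) * (1 + v) ^ (N + n) * Real.exp (-t * v)) := by
  have h1 : v ^ n ≤ (1 + v) ^ n := pow_le_pow_left₀ hv.le (by linarith) n
  have h2 := hρ v hv
  rw [norm_mul, norm_mul, Real.norm_eq_abs, Real.norm_eq_abs, Real.norm_eq_abs,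
    abs_of_pos (pow_pos hv n), abs_of_pos (Real.exp_pos _)]
  calc _ ≤ (1 + v) ^ n * (C * (v ^ (σ - 1) * (1 + v) ^ N)) * Real.exp (-t * v) := by
        gcongr
    _ = _ := by rw [pow_add]; ring

lemma integrableOn_laplace_integrand (hσ : 0 < σ)
    (hm : AEStronglyMeasurable ρ (volume.restrict (Set.Ioi 0)))
    (hρ : ∀ v, 0 < v → |ρ v| ≤ C * (v ^ (σ - 1) * (1 + v) ^ N)) (n : ℕ) {t : ℝ} (ht : 0 < t) :
    IntegrableOn (fun v => v ^ n * ρ v * Real.exp (-t * v)) (Set.Ioi 0) := by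
  refine ((integrableOn_rpow_mul_one_add_pow_mul_exp_mul hσ (N + n) ht).const_mul C).mono' ?_ ?_
  · exact ((by fun_prop : Continuous fun v : ℝ => v ^ n).aestronglyMeasurable.mul hm).mul
      (by fun_prop : Continuous fun v : ℝ => Real.exp (-t * v)).aestronglyMeasurable
  · exact (ae_restrict_iff' measurableSet_Ioi).mpr (Filter.Eventually.of_forall fun v hv =>
      norm_laplace_integrand_le hρ n t hv)

lemma hasDerivAt_laplace (hσ : 0 < σ)
    (hm : AEStronglyMeasurable ρ (volume.restrict (Set.Ioi 0)))
    (hρ : ∀ v, 0 < v → |ρ v| ≤ C * (v ^ (σ - 1) * (1 + v) ^ N)) (n : ℕ) {t : ℝ} (ht : 0 < t) :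
    HasDerivAt (fun t => ∫ v in Set.Ioi (0 : ℝ), v ^ n * ρ v * Real.exp (-t * v))
      (-∫ v in Set.Ioi (0 : ℝ), v ^ (n + 1) * ρ v * Real.exp (-t * v)) t := by
  rw [← integral_neg]
  -- On (t/2, ∞) the exponential is dominated by e^{-tv/2}, uniformly in the parameter.
  refine (hasDerivAt_integral_of_dominated_loc_of_deriv_le (s := Set.Ioi (t / 2))
    (F := fun t v => v ^ n * ρ v * Real.exp (-t * v))
    (F' := fun t v => -(v ^ (n + 1) * ρ v * Real.exp (-t * v)))
    (bound := fun v => C * (v ^ (σ - 1) * (1 + v) ^ (N + (n + 1)) * Real.exp (-(t / 2) * v)))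
    (isOpen_Ioi.mem_nhds (by simp only [Set.mem_Ioi]; linarith)) ?_
    (integrableOn_laplace_integrand hσ hm hρ n ht)
    (integrableOn_laplace_integrand hσ hm hρ (n + 1) ht).aestronglyMeasurable.neg ?_
    ((integrableOn_rpow_mul_one_add_pow_mul_exp_mul hσ (N + (n + 1)) (by linarith)).const_mul C)
    ?_).2
  · filter_upwards [isOpen_Ioi.mem_nhds (show t ∈ Set.Ioi 0 from ht)] with τ hτ
    exact (integrableOn_laplace_integrand hσ hm hρ n hτ).aestronglyMeasurable
  · refine (ae_restrict_iff' measurableSet_Ioi).mpr (Filter.Eventually.of_forall fun v hv τ hτ => ?_)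
    rw [norm_neg]
    rw [Set.mem_Ioi] at hv hτ
    have h0 : 0 ≤ C * (v ^ (σ - 1) * (1 + v) ^ (N + (n + 1))) := by
      have := (abs_nonneg _).trans (hρ v hv)
      rw [pow_add, ← mul_assoc, ← mul_assoc]
      rw [← mul_assoc] at this
      exact mul_nonneg this (by positivity)
    calc _ ≤ C * (v ^ (σ - 1) * (1 + v) ^ (N + (n + 1)) * Real.exp (-τ * v)) :=
          norm_laplace_integrand_le hρ (n + 1) τ hv
      _ = C * (v ^ (σ - 1) * (1 + v) ^ (N + (n + 1))) * Real.exp (-τ * v) := by ring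
      _ ≤ C * (v ^ (σ - 1) * (1 + v) ^ (N + (n + 1))) * Real.exp (-(t / 2) * v) := by
          refine mul_le_mul_of_nonneg_left (Real.exp_le_exp.mpr ?_) h0
          nlinarith
      _ = _ := by ring
  · refine Filter.Eventually.of_forall fun v τ _ => ?_
    have h1 : HasDerivAt (fun τ : ℝ => -τ * v) (-1 * v) τ :=
      ((hasDerivAt_id τ).neg).mul_const v
    refine (h1.exp.const_mul (v ^ n * ρ v)).congr_deriv ?_
    rw [pow_succ]
    ring

/-- The density may vanish at some points; positivity on an initial interval already makes the
integral strictly positive. -/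
lemma laplace_pos (hσ : 0 < σ)
    (hm : AEStronglyMeasurable ρ (volume.restrict (Set.Ioi 0)))
    (hρ : ∀ v, 0 < v → |ρ v| ≤ C * (v ^ (σ - 1) * (1 + v) ^ N)) (h0 : ∀ v, 0 < v → 0 ≤ ρ v)
    {ε : ℝ} (hε : 0 < ε) (hpos : ∀ v, 0 < v → v < ε → 0 < ρ v) (n : ℕ) {t : ℝ} (ht : 0 < t) :
    0 < ∫ v in Set.Ioi (0 : ℝ), v ^ n * ρ v * Real.exp (-t * v) := by
  rw [setIntegral_pos_iff_support_of_nonneg_ae]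
  · refine lt_of_lt_of_le ?_ (measure_mono (show Set.Ioo 0 ε ⊆ _ from fun v hv => ⟨?_, hv.1⟩))
    · simp [hε]
    · rw [Function.mem_support]
      have := hpos v hv.1 hv.2
      have := hv.1
      positivity
  · refine (ae_restrict_iff' measurableSet_Ioi).mpr (Filter.Eventually.of_forall fun v hv => ?_)
    have := h0 v hv
    rw [Set.mem_Ioi] at hv
    simp only [Pi.zero_apply]
    positivity
  · exact integrableOn_laplace_integrand hσ hm hρ n ht

/-- Laplace transforms of nonnegative densities are completely monotone. -/
lemma strictlyCompletelyMonotone_of_laplace (hσ : 0 < σ)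
    (hm : AEStronglyMeasurable ρ (volume.restrict (Set.Ioi 0)))
    (hρ : ∀ v, 0 < v → |ρ v| ≤ C * (v ^ (σ - 1) * (1 + v) ^ N)) (h0 : ∀ v, 0 < v → 0 ≤ ρ v)
    {ε : ℝ} (hε : 0 < ε) (hpos : ∀ v, 0 < v → v < ε → 0 < ρ v) {A : ℝ} (hA : 0 < A) {f : ℝ → ℝ}
    (hf : ∀ t, 0 < t → f t = A * ∫ v in Set.Ioi (0 : ℝ), ρ v * Real.exp (-t * v)) :
    StrictlyCompletelyMonotone f := by
  set L : ℕ → ℝ → ℝ := fun n t => ∫ v in Set.Ioi (0 : ℝ), v ^ n * ρ v * Real.exp (-t * v) with hL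
  have hfL : Set.EqOn f (fun t => A * L 0 t) (Set.Ioi 0) := by
    intro t ht
    simp only [hf t ht, hL, pow_zero, one_mul]
  have hd : ∀ n t, 0 < t → HasDerivAt (L n) (-L (n + 1) t) t := fun n t ht =>
    hasDerivAt_laplace hσ hm hρ n ht
  have hsmooth : ∀ j n : ℕ, ContDiffOn ℝ j (L n) (Set.Ioi 0) := by
    intro j
    induction j with
    | zero =>
      intro n
      exact contDiffOn_zero.mpr fun t ht => (hd n t ht).continuousAt.continuousWithinAt
    | succ j ih =>
      intro n
      push_cast
      rw [contDiffOn_succ_iff_deriv_of_isOpen isOpen_Ioi]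
      refine ⟨fun t ht => (hd n t ht).differentiableAt.differentiableWithinAt, by simp, ?_⟩
      exact ((ih (n + 1)).neg).congr fun t ht => (hd n t ht).deriv
  refine ⟨?_, fun n t ht => ?_⟩
  · rw [contDiffOn_infty]
    intro j
    exact (contDiffOn_const.mul (hsmooth j 0)).congr hfL
  · have hiter : ∀ n, ∀ t, 0 < t → iteratedDeriv n f t = (-1) ^ n * (A * L n t) := by
      intro n
      induction n with
      | zero => intro t ht; simpa using hfL ht
      | succ n ih =>
        intro t ht
        rw [iteratedDeriv_succ]
        have he : iteratedDeriv n f =ᶠ[nhds t] fun t => (-1) ^ n * (A * L n t) := by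
          filter_upwards [isOpen_Ioi.mem_nhds (show t ∈ Set.Ioi 0 from ht)] with τ hτ
          exact ih τ hτ
        rw [he.deriv_eq, (((hd n t ht).const_mul A).const_mul _).deriv]
        ring
    rw [hiter n t ht, ← mul_assoc, ← mul_pow]
    have := laplace_pos hσ hm hρ h0 hε hpos n ht
    simp only [neg_mul, neg_neg, one_mul, one_pow, mul_neg]
    exact mul_pos hA this

end LaplaceTransform

/-! ### Sign of the hypergeometric function with conjugate parameters -/

section Conjugate

lemma hypReal_zero (a b : ℂ) (c : ℝ) : hypReal a b c 0 = 1 := by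
  simp [hypReal, hypSum_zero]

/-- Because (a + j)(ā + j) = |a + j|², the coefficients are real, and nonnegative for c > 0. Both
the reality of H and its positivity on [0, 1) come from this. -/
lemma hypCoeff_conj_eq (a : ℂ) (c : ℝ) (n : ℕ) :
    hypCoeff a (starRingEnd ℂ a) c n =
      ((∏ j ∈ Finset.range n, Complex.normSq (a + j) / ((c + j) * (1 + j)) : ℝ) : ℂ) := by
  rw [hypCoeff]
  push_cast
  refine Finset.prod_congr rfl fun j _ => ?_
  rw [← Complex.mul_conj, map_add, Complex.conj_natCast]

lemma hasSum_hypSum_conj (a : ℂ) {c : ℝ} (hc : 0 < c) {z : ℝ} (hz : |z| < 1) :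
    HasSum (fun n : ℕ => (((∏ j ∈ Finset.range n, Complex.normSq (a + j) / ((c + j) * (1 + j))) *
      z ^ n : ℝ) : ℂ)) (hypReal a (starRingEnd ℂ a) c z) := by
  rw [hypReal_eq_hypSum _ _ hc hz]
  have := hasSum_hypSum a (starRingEnd ℂ a) hc (z := (z : ℂ)) (by simpa using hz)
  simp only [hypCoeff_conj_eq] at this
  simpa using this

/-- For conjugate parameters the hypergeometric function is real. -/
lemma hypReal_conj_im (a : ℂ) {c : ℝ} (hc : 0 < c) {z : ℝ} (hz : z < 1) :
    (hypReal a (starRingEnd ℂ a) c z).im = 0 := by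
  have han := analyticOnNhd_hypReal a (starRingEnd ℂ a) hc
  have h1 : AnalyticOnNhd ℝ (fun z => (hypReal a (starRingEnd ℂ a) c z).im) (Set.Iio 1) :=
    fun z hz => (Complex.imCLM.analyticAt _).comp (han z hz)
  refine h1.eqOn_of_preconnected_of_eventuallyEq (g := fun _ => 0) analyticOnNhd_const
    isPreconnected_Iio (show (0 : ℝ) ∈ Set.Iio 1 by simp) ?_ hz
  filter_upwards [(isOpen_lt continuous_abs continuous_const).mem_nhds
    (show (0 : ℝ) ∈ {z : ℝ | |z| < 1} by simp)] with z hz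
  rw [← (hasSum_hypSum_conj a hc hz).tsum_eq, ← Complex.ofReal_tsum, Complex.ofReal_im]

lemma hypReal_conj_re_pos (a : ℂ) {c : ℝ} (hc : 0 < c) {z : ℝ} (hz0 : 0 ≤ z) (hz : z < 1) :
    0 < (hypReal a (starRingEnd ℂ a) c z).re := by
  have h := Complex.hasSum_re (hasSum_hypSum_conj a hc (z := z) (by rwa [abs_of_nonneg hz0]))
  simp only [Complex.ofReal_re] at h
  have := le_hasSum h 0 fun n _ => by
    refine mul_nonneg (Finset.prod_nonneg fun j _ => ?_) (pow_nonneg hz0 n)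
    have := Complex.normSq_nonneg (a + j)
    positivity
  simp at this
  linarith

lemma continuousOn_hypReal_re (a b : ℂ) {c : ℝ} (hc : 0 < c) :
    ContinuousOn (fun z => (hypReal a b c z).re) (Set.Iio 1) :=
  Complex.continuous_re.comp_continuousOn (analyticOnNhd_hypReal a b hc).continuousOn

/-- The function is positive to the right of its largest negative zero. -/
lemma hypReal_conj_re_pos_of_no_zero (a : ℂ) {c : ℝ} (hc : 0 < c) {z : ℝ} (hz : z < 1)
    (hno : ∀ y, z ≤ y → y < 0 → hypReal a (starRingEnd ℂ a) c y ≠ 0) :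
    0 < (hypReal a (starRingEnd ℂ a) c z).re := by
  rcases le_or_gt 0 z with h | h
  · exact hypReal_conj_re_pos a hc h hz
  · by_contra! hneg
    have hcont : ContinuousOn (fun z => (hypReal a (starRingEnd ℂ a) c z).re) (Set.Icc z 0) :=
      (continuousOn_hypReal_re a _ hc).mono fun y hy => lt_of_le_of_lt hy.2 one_pos
    -- A nonpositive value at z and the value 1 at 0 force a zero of the real part, which is a zero
    -- of the function since it is real.
    obtain ⟨y, hy, hy0⟩ := intermediate_value_Icc h.le hcont
      (show (0 : ℝ) ∈ Set.Icc _ _ from ⟨hneg, by simp [hypReal_zero]⟩)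
    have hy1 : y ≠ 0 := by rintro rfl; simp [hypReal_zero] at hy0
    exact hno y hy.1 (lt_of_le_of_ne hy.2 hy1)
      (Complex.ext hy0 (hypReal_conj_im a hc (lt_of_le_of_lt hy.2 one_pos)))

end Conjugate

/-! ### The real form of the density and of |V|² -/

lemma conj_cpow_of_mem_slitPlane {x : ℂ} (hx : x ∈ Complex.slitPlane) (n : ℂ) :
    starRingEnd ℂ (x ^ n) = (starRingEnd ℂ x) ^ (starRingEnd ℂ n) := by
  have := Complex.cpow_conj (starRingEnd ℂ x) n
    (Complex.mem_slitPlane_iff_arg.mp (conj_mem_slitPlane hx)).1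
  rw [this, Complex.conj_conj]

/-- For real μ this turns the left side of the product formula into |V|². -/
lemma conj_whittV (α : ℂ) (μ : ℝ) {w : ℂ} (hw : w ∈ Complex.slitPlane) :
    starRingEnd ℂ (whittV α μ w) = whittV (starRingEnd ℂ α) μ (starRingEnd ℂ w) := by
  rw [whittV, whittV, map_mul, map_inv₀, ← Complex.Gamma_conj, map_add, Complex.conj_ofReal,
    ← integral_conj]
  congr 1
  refine setIntegral_congr_fun measurableSet_Ioi fun s hs => ?_
  rw [Set.mem_Ioi] at hs
  have h1 : (s : ℂ) ∈ Complex.slitPlane := Complex.ofReal_mem_slitPlane.mpr hs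
  simp only [map_mul]
  rw [conj_cpow_of_mem_slitPlane h1, conj_cpow_of_mem_slitPlane (one_add_mul_mem_slitPlane hw hs.le),
    ← Complex.exp_conj]
  simp

/-- The density as a positive weight times the hypergeometric function with conjugate parameters. -/
lemma productDensity_eq {α : ℂ} (hα : 0 < α.re) (μ : ℝ) {w : ℂ} (hw : w ∈ Complex.slitPlane)
    {x : ℝ} (hx : 0 < x) :
    productDensity α μ w x = ((x ^ (2 * α.re - 1) *
        Real.exp (-(2 * (Complex.log (1 + x * w) * (α + μ)).re)) : ℝ) : ℂ) *
      hypReal (α + μ) (starRingEnd ℂ (α + μ)) (2 * α.re) (1 - (‖1 + x * w‖ ^ 2)⁻¹) := by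
  have hc : 0 < 2 * α.re := by linarith
  set y : ℂ := 1 + x * w with hy
  have hys : y ∈ Complex.slitPlane := one_add_mul_mem_slitPlane hw hx.le
  have hy0 : y ≠ 0 := Complex.slitPlane_ne_zero hys
  have hyn : 0 < ‖y‖ ^ 2 := by have := norm_pos_iff.mpr hy0; positivity
  have e1 : 1 + (x : ℂ) * starRingEnd ℂ w = starRingEnd ℂ y := by
    rw [hy, map_add, map_mul, Complex.conj_ofReal, map_one]
  have e2 : (1 - ‖y‖ ^ 2) / (1 - ‖y‖ ^ 2 - 1) = 1 - (‖y‖ ^ 2)⁻¹ := by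
    rw [show 1 - ‖y‖ ^ 2 - 1 = -‖y‖ ^ 2 by ring]
    field_simp
    ring
  have e3 : ((2 * α.re : ℝ) : ℂ) - (α - μ) = starRingEnd ℂ (α + μ) := by
    rw [← add_conj_eq, map_add, Complex.conj_ofReal]; ring
  have e4 : (x : ℂ) ^ (((2 * α.re : ℝ) : ℂ) - 1) = ((x ^ (2 * α.re - 1) : ℝ) : ℂ) := by
    rw [Complex.ofReal_cpow hx.le]; push_cast; rfl
  have e5 : (1 : ℂ) - ((1 - ‖y‖ ^ 2 : ℝ) : ℂ) = ((‖y‖ ^ 2 : ℝ) : ℂ) := by push_cast; ring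
  have hlogc : Complex.log (starRingEnd ℂ y) = starRingEnd ℂ (Complex.log y) :=
    Complex.log_conj y (Complex.mem_slitPlane_iff_arg.mp hys).1
  have e6 : ((Real.log (‖y‖ ^ 2) : ℝ) : ℂ) = Complex.log y + starRingEnd ℂ (Complex.log y) := by
    rw [Complex.add_conj, Complex.log_re, Real.log_pow]
    push_cast
    ring
  have e7 : (starRingEnd ℂ y) ^ (α - starRingEnd ℂ α) *
      (1 - ((1 - ‖y‖ ^ 2 : ℝ) : ℂ)) ^ (-(α + μ)) =
      ((Real.exp (-(2 * (Complex.log y * (α + μ)).re)) : ℝ) : ℂ) := by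
    rw [e5, ofReal_cpow_eq_exp hyn, Complex.cpow_def_of_ne_zero
      (by simpa using hy0 : starRingEnd ℂ y ≠ 0), hlogc, ← Complex.exp_add, Complex.ofReal_exp, e6]
    congr 1
    rw [Complex.ofReal_neg, ← Complex.add_conj, map_mul, map_add, Complex.conj_ofReal]
    ring
  -- Pfaff's transformation moves the argument from 1 - |y|² to 1 - |y|⁻² and turns the second
  -- parameter α - μ into ᾱ + μ, the conjugate of the first. Its prefactor combines with the power
  -- of ȳ into a positive real number.
  rw [productDensity, e1, pfaff_hypReal _ _ hc (one_sub_norm_sq_lt_one hw hx.le), ← hy, e2, e3,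
    e4, Complex.ofReal_mul (x ^ (2 * α.re - 1)), ← e7]
  ring

lemma productDensity_im {α : ℂ} (hα : 0 < α.re) (μ : ℝ) {w : ℂ} (hw : w ∈ Complex.slitPlane)
    {x : ℝ} (hx : 0 < x) : (productDensity α μ w x).im = 0 := by
  have hpos : 0 < ‖1 + x * w‖ :=
    norm_pos_iff.mpr (Complex.slitPlane_ne_zero (one_add_mul_mem_slitPlane hw hx.le))
  rw [productDensity_eq hα μ hw hx, Complex.im_ofReal_mul,
    hypReal_conj_im _ (by linarith) (by have : 0 < (‖1 + x * w‖ ^ 2)⁻¹ := by positivity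
                                        linarith), mul_zero]

lemma productDensity_re {α : ℂ} (hα : 0 < α.re) (μ : ℝ) {w : ℂ} (hw : w ∈ Complex.slitPlane)
    {x : ℝ} (hx : 0 < x) :
    (productDensity α μ w x).re = x ^ (2 * α.re - 1) *
        Real.exp (-(2 * (Complex.log (1 + x * w) * (α + μ)).re)) *
      (hypReal (α + μ) (starRingEnd ℂ (α + μ)) (2 * α.re) (1 - (‖1 + x * w‖ ^ 2)⁻¹)).re := by
  rw [productDensity_eq hα μ hw hx, Complex.re_ofReal_mul]

/-- The homogeneity of the density. -/
lemma productDensity_scale (α μ w : ℂ) {t v : ℝ} (ht : 0 < t) (hv : 0 < v) :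
    productDensity α μ ((t : ℂ)⁻¹ * w) (t * v) =
      ((t ^ (2 * α.re - 1) : ℝ) : ℂ) * productDensity α μ w v := by
  have ht0 : (t : ℂ) ≠ 0 := by exact_mod_cast ht.ne'
  have e1 : ((t * v : ℝ) : ℂ) * ((t : ℂ)⁻¹ * w) = v * w := by
    push_cast; field_simp
  have e2 : ((t * v : ℝ) : ℂ) * starRingEnd ℂ ((t : ℂ)⁻¹ * w) = v * starRingEnd ℂ w := by
    rw [map_mul, map_inv₀, Complex.conj_ofReal]; push_cast; field_simp
  rw [productDensity, productDensity, e1, e2, Complex.ofReal_mul,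
    Complex.mul_cpow_ofReal_nonneg ht.le hv.le, Complex.ofReal_cpow ht.le]
  push_cast
  ring

lemma mul_mem_slitPlane_of_pos {w : ℂ} (hw : w ∈ Complex.slitPlane) {t : ℝ} (ht : 0 < t) :
    (t : ℂ) * w ∈ Complex.slitPlane := by
  rw [Complex.mem_slitPlane_iff] at hw ⊢
  simpa [ht, ht.ne'] using hw

lemma inv_mem_slitPlane {w : ℂ} (hw : w ∈ Complex.slitPlane) : w⁻¹ ∈ Complex.slitPlane := by
  have hn : 0 < Complex.normSq w := Complex.normSq_pos.mpr (Complex.slitPlane_ne_zero hw)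
  rw [Complex.inv_def, mul_comm]
  exact mul_mem_slitPlane_of_pos (conj_mem_slitPlane hw) (by positivity)

/-- `|V|²` as a real Laplace transform. -/
lemma norm_whittV_sq {α : ℂ} (hα : 0 < α.re) {μ : ℝ} (hμ : 0 ≤ μ) {w : ℂ}
    (hw : w ∈ Complex.slitPlane) {t : ℝ} (ht : 0 < t) :
    ‖whittV α μ ((t : ℂ)⁻¹ * w)‖ ^ 2 = (Real.Gamma (2 * α.re))⁻¹ * (t ^ (2 * α.re) *
      ∫ v in Set.Ioi (0 : ℝ), (productDensity α μ w v).re * Real.exp (-t * v)) := by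
  have hw' : (t : ℂ)⁻¹ * w ∈ Complex.slitPlane := by
    rw [← Complex.ofReal_inv]; exact mul_mem_slitPlane_of_pos hw (by positivity)
  have h := whittV_mul_conj (μ := μ) hα (by simp; linarith) hw'
  rw [← conj_whittV α μ hw', Complex.mul_conj, Complex.normSq_eq_norm_sq] at h
  have hscale := integral_comp_mul_left_Ioi (fun x : ℝ => productDensity α μ ((t : ℂ)⁻¹ * w) x *
    Complex.exp (-(x : ℂ))) 0 ht
  rw [mul_zero, eq_inv_smul_iff₀ ht.ne'] at hscale
  have hpt : ∀ v ∈ Set.Ioi (0 : ℝ), productDensity α μ ((t : ℂ)⁻¹ * w) (t * v) *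
      Complex.exp (-((t * v : ℝ) : ℂ)) = ((t ^ (2 * α.re - 1) *
        ((productDensity α μ w v).re * Real.exp (-t * v)) : ℝ) : ℂ) := by
    intro v hv
    rw [productDensity_scale α μ w ht hv]
    have : productDensity α μ w v = ((productDensity α μ w v).re : ℂ) :=
      Complex.ext (by simp) (by simpa using productDensity_im hα μ hw hv)
    rw [this]
    push_cast
    rw [neg_mul, Complex.ofReal_re]
    ring
  rw [← hscale, setIntegral_congr_fun measurableSet_Ioi hpt, integral_complex_ofReal,
    integral_const_mul, Complex.Gamma_ofReal, Complex.real_smul,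
    ← Complex.ofReal_inv (Real.Gamma (2 * α.re)),
    ← Complex.ofReal_mul, ← Complex.ofReal_mul, Complex.ofReal_inj] at h
  rw [h, ← mul_assoc t]
  congr 2
  rw [Real.rpow_sub_one ht.ne']
  field_simp

/-! ### Whittaker's function as a Laplace transform -/

lemma whittakerW_eq (k : ℂ) (m : ℝ) (z : ℂ) :
    whittakerW k m z = Complex.exp (-z / 2) * z ^ k * whittV (1 / 2 - k) (|m| : ℝ) z⁻¹ := by
  rw [whittakerW, whittV, div_eq_mul_inv, mul_assoc (Complex.exp (-z / 2) * z ^ k)]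
  congr 2
  · ring_nf
  · refine setIntegral_congr_fun measurableSet_Ioi fun s _ => ?_
    simp only [div_eq_mul_inv]
    ring_nf

/-- The Laplace representation of the weighted squared modulus of Whittaker's function. -/
lemma whittakerModulus_eq_laplace {k : ℂ} (hk : k.re < 1 / 2) (m : ℝ) {x : ℂ}
    (hx : x ∈ Complex.slitPlane) {t : ℝ} (ht : 0 < t) :
    whittakerModulus k m x t = (‖x ^ k‖ ^ 2 * (Real.Gamma (2 * (1 / 2 - k).re))⁻¹) *
      ∫ v in Set.Ioi (0 : ℝ), (productDensity (1 / 2 - k) (|m| : ℝ) x⁻¹ v).re *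
        Real.exp (-t * v) := by
  have hα : 0 < (1 / 2 - k).re := by simp; linarith
  have hα2 : 2 * (1 / 2 - k).re = 1 - 2 * k.re := by simp; ring
  have hpow : ((t : ℂ) * x) ^ k = (t : ℂ) ^ k * x ^ k := by
    have ht0 : (t : ℂ) ≠ 0 := by exact_mod_cast ht.ne'
    have hx0 := Complex.slitPlane_ne_zero hx
    rw [Complex.cpow_def_of_ne_zero (mul_ne_zero ht0 hx0), Complex.log_ofReal_mul ht hx0, add_mul,
      Complex.exp_add, Complex.cpow_def_of_ne_zero ht0, Complex.cpow_def_of_ne_zero hx0,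
      Complex.ofReal_log ht.le]
  have hexp : ‖Complex.exp (-((t : ℂ) * x) / 2)‖ ^ 2 = Real.exp (-(t * x.re)) := by
    rw [Complex.norm_exp, ← Real.exp_nat_mul]
    congr 1
    rw [show -((t : ℂ) * x) / 2 = ((t / 2 : ℝ) : ℂ) * (-x) by push_cast; ring,
      Complex.re_ofReal_mul, Complex.neg_re]
    push_cast
    ring
  -- The powers t⁻¹, t^{2 Re k} and t^{1 - 2 Re k} cancel, and e^{t Re x} cancels the squared
  -- modulus of e^{-tx/2}.
  rw [whittakerModulus, whittakerW_eq, mul_inv, norm_mul, norm_mul, mul_pow, mul_pow,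
    norm_whittV_sq hα (abs_nonneg m) (inv_mem_slitPlane hx) ht, hexp, hpow, norm_mul, mul_pow,
    Complex.norm_cpow_eq_rpow_re_of_pos ht, Real.exp_neg, hα2,
    Real.rpow_sub ht, Real.rpow_one, mul_comm 2 k.re, Real.rpow_mul ht.le, Real.rpow_two]
  have h1 : t ^ k.re ≠ 0 := by positivity
  have h2 : Real.exp (t * x.re) ≠ 0 := by positivity
  field_simp

/-- Complete monotonicity follows from nonnegativity of the hypergeometric function on the curve of
arguments. -/
lemma strictlyCompletelyMonotone_whittakerModulus {k : ℂ} (hk : k.re < 1 / 2) (m : ℝ) {x : ℂ}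
    (hx : x ∈ Complex.slitPlane)
    (hnonneg : ∀ v : ℝ, 0 < v → 0 ≤ (hypReal (1 / 2 - k + (|m| : ℝ))
      (starRingEnd ℂ (1 / 2 - k + (|m| : ℝ))) (2 * (1 / 2 - k).re)
        (1 - (‖1 + v * x⁻¹‖ ^ 2)⁻¹)).re) :
    StrictlyCompletelyMonotone (whittakerModulus k m x) := by
  have hα : 0 < (1 / 2 - k).re := by simp; linarith
  have hc : 0 < 2 * (1 / 2 - k).re := by linarith
  have hw := inv_mem_slitPlane hx
  have hx0 := Complex.slitPlane_ne_zero hx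
  obtain ⟨V, hV, C, N, hb⟩ := exists_nhds_productDensity_bound hα ((|m| : ℝ) : ℂ) hw
  have hwt : ∀ v : ℝ, 0 < v → 0 < v ^ (2 * (1 / 2 - k).re - 1) *
      Real.exp (-(2 * (Complex.log (1 + v * x⁻¹) * (1 / 2 - k + (|m| : ℝ))).re)) := by
    intro v hv; positivity
  -- As v → 0 the argument tends to 0, where the function equals 1; this supplies the interval (0,
  -- ε) on which the density is strictly positive.
  have hcont : ContinuousAt (fun v : ℝ => (hypReal (1 / 2 - k + (|m| : ℝ))
      (starRingEnd ℂ (1 / 2 - k + (|m| : ℝ))) (2 * (1 / 2 - k).re)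
        (1 - (‖1 + v * x⁻¹‖ ^ 2)⁻¹)).re) 0 := by
    have h1 : ContinuousAt (fun v : ℝ => 1 - (‖1 + v * x⁻¹‖ ^ 2)⁻¹) 0 := by
      refine ContinuousAt.sub continuousAt_const (ContinuousAt.inv₀ (by fun_prop) (by simp))
    refine ContinuousAt.comp (g := fun z => (hypReal (1 / 2 - k + (|m| : ℝ))
      (starRingEnd ℂ (1 / 2 - k + (|m| : ℝ))) (2 * (1 / 2 - k).re) z).re) ?_ h1
    refine (continuousOn_hypReal_re _ _ hc).continuousAt (isOpen_Iio.mem_nhds ?_)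
    simp
  have hev := hcont.eventually_const_lt (u := 0) (by simp [hypReal_zero])
  obtain ⟨ε, hε, hball⟩ := Metric.eventually_nhds_iff.mp hev
  refine strictlyCompletelyMonotone_of_laplace (σ := 2 * (1 / 2 - k).re) (N := N) (C := C)
    (ρ := fun v => (productDensity (1 / 2 - k) (|m| : ℝ) x⁻¹ v).re) hc
    (aestronglyMeasurable_productDensity hα _ hw).re
    (fun v hv => (Complex.abs_re_le_norm _).trans (hb _ (mem_of_mem_nhds hV) v hv)) ?_ hε ?_
    (A := ‖x ^ k‖ ^ 2 * (Real.Gamma (2 * (1 / 2 - k).re))⁻¹) ?_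
    (fun t ht => whittakerModulus_eq_laplace hk m hx ht)
  · intro v hv
    rw [productDensity_re hα _ hw hv]
    exact mul_nonneg (hwt v hv).le (hnonneg v hv)
  · intro v hv hvε
    rw [productDensity_re hα _ hw hv]
    exact mul_pos (hwt v hv) (hball (by rwa [Real.dist_0_eq_abs, abs_of_pos hv]))
  · have h1 : 0 < ‖x ^ k‖ := norm_pos_iff.mpr (by simp [Complex.cpow_eq_zero_iff, hx0])
    have h2 := Real.Gamma_pos_of_pos hc
    positivity

/-! ### Negative zeros and the geometry of the sector -/

/-- F is formed with m, the density with |m|. For m < 0 Euler's transformation replaces m by -m at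
the cost of a nonvanishing power of 1 - z. -/
lemma negativeZeros_eq {k : ℂ} (hk : k.re < 1 / 2) (m : ℝ) :
    negativeZeros k m = {z : ℝ | z < 0 ∧ hypReal (1 / 2 - k + (|m| : ℝ))
      (starRingEnd ℂ (1 / 2 - k + (|m| : ℝ))) (2 * (1 / 2 - k).re) z = 0} := by
  have hc : 0 < 2 * (1 / 2 - k).re := by simp; linarith
  have hcc : (1 - 2 * (k.re : ℂ)) = ((2 * (1 / 2 - k).re : ℝ) : ℂ) := by
    simp; ring
  have hadd := add_conj_eq (1 / 2 - k)
  have hconj : starRingEnd ℂ (1 / 2 - k) = 1 / 2 - starRingEnd ℂ k := by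
    rw [map_sub, map_div₀, map_one, map_ofNat]
  ext z
  simp only [negativeZeros, Set.mem_ofPred_eq]
  refine and_congr_right fun hz => ?_
  have hz1 : z < 1 := by linarith
  have hzne : (1 - (z : ℂ)) ≠ 0 := by
    rw [← Complex.ofReal_one, ← Complex.ofReal_sub, Complex.ofReal_ne_zero]; linarith
  rw [hcc, hyp2F1_eq_hypReal _ _ hc hz1, map_add, Complex.conj_ofReal, hconj]
  rcases le_or_gt 0 m with h | h
  · rw [abs_of_nonneg h, show (1 / 2 + (m : ℂ) - k) = 1 / 2 - k + m by ring,
      show (1 / 2 + (m : ℂ) - starRingEnd ℂ k) = 1 / 2 - starRingEnd ℂ k + m by ring]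
  · rw [abs_of_neg h, euler_hypReal _ _ hc hz1, mul_eq_zero, Complex.cpow_eq_zero_iff, ← hadd, hconj,
      hypReal_symm _ _ hc hz1,
      show 1 / 2 - k + (1 / 2 - starRingEnd ℂ k) - (1 / 2 + (m : ℂ) - starRingEnd ℂ k) =
        1 / 2 - k + ((-m : ℝ) : ℂ) by push_cast; ring,
      show 1 / 2 - k + (1 / 2 - starRingEnd ℂ k) - (1 / 2 + (m : ℂ) - k) =
        1 / 2 - starRingEnd ℂ k + ((-m : ℝ) : ℂ) by push_cast; ring]
    simp [hzne]

/-- The largest negative zero exists. -/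
lemma exists_isGreatest_negativeZeros {k : ℂ} (hk : k.re < 1 / 2) {m : ℝ}
    (hne : (negativeZeros k m).Nonempty) : ∃ p, IsGreatest (negativeZeros k m) p := by
  have hc : 0 < 2 * (1 / 2 - k).re := by simp; linarith
  rw [negativeZeros_eq hk] at hne ⊢
  set H := hypReal (1 / 2 - k + (|m| : ℝ)) (starRingEnd ℂ (1 / 2 - k + (|m| : ℝ)))
    (2 * (1 / 2 - k).re) with hH
  -- As H(0) = 1, adding the point 0 to the half-line adds no zero, so the set is closed and
  -- contains its supremum.
  have hS : {z : ℝ | z < 0 ∧ H z = 0} = Set.Iic 0 ∩ H ⁻¹' {0} := by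
    ext z
    simp only [Set.mem_ofPred_eq, Set.mem_inter_iff, Set.mem_Iic, Set.mem_preimage,
      Set.mem_singleton_iff]
    refine and_congr_left fun hz => ⟨le_of_lt, fun h => lt_of_le_of_ne h ?_⟩
    rintro rfl
    simp [hH, hypReal_zero] at hz
  have hclosed : IsClosed {z : ℝ | z < 0 ∧ H z = 0} := by
    rw [hS]
    refine ContinuousOn.preimage_isClosed_of_isClosed ?_ isClosed_Iic isClosed_singleton
    exact (analyticOnNhd_hypReal _ _ hc).continuousOn.mono fun y hy => lt_of_le_of_lt (show y ≤ 0 from hy) one_pos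
  exact ⟨_, hclosed.isGreatest_csSup hne ⟨0, fun z hz => hz.1.le⟩⟩

/-- The argument of the hypergeometric function stays to the right of `-q` in the sector. -/
lemma neg_le_one_sub_inv_norm_sq {q : ℝ} (hq : 0 < q) {w : ℂ} (hw : w ∈ Complex.slitPlane)
    (h : w.re < 0 → w.re ^ 2 ≤ q * w.im ^ 2) {v : ℝ} (hv : 0 < v) :
    -q ≤ 1 - (‖1 + v * w‖ ^ 2)⁻¹ := by
  have hpos : 0 < ‖1 + v * w‖ :=
    norm_pos_iff.mpr (Complex.slitPlane_ne_zero (one_add_mul_mem_slitPlane hw hv.le))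
  have hn : ‖1 + v * w‖ ^ 2 = (1 + v * w.re) ^ 2 + v ^ 2 * w.im ^ 2 := by
    rw [Complex.sq_norm, Complex.normSq_apply]
    simp
    ring
  have key : 1 ≤ (1 + q) * ‖1 + v * w‖ ^ 2 := by
    rw [hn]
    rcases le_or_gt 0 w.re with hr | hr
    · have h1 : 0 ≤ v * w.re := by positivity
      have h2 : 0 ≤ v ^ 2 * w.im ^ 2 := by positivity
      nlinarith
    · have h1 := mul_le_mul_of_nonneg_left (h hr) (sq_nonneg v)
      -- On the boundary ray (Re w)² = q (Im w)², this square is q times the difference of the two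
      -- sides of `key`; `h3` is the slack inside the sector.
      have h2 : 0 ≤ (q + (1 + q) * (v * w.re)) ^ 2 := sq_nonneg _
      have h3 : 0 ≤ (1 + q) * (v ^ 2 * (q * w.im ^ 2) - v ^ 2 * w.re ^ 2) :=
        mul_nonneg (by linarith) (by linarith)
      have h4 : 0 ≤ q * ((1 + q) * ((1 + v * w.re) ^ 2 + v ^ 2 * w.im ^ 2) - 1) := by
        nlinarith
      nlinarith [nonneg_of_mul_nonneg_right h4 hq]
  have : (‖1 + v * w‖ ^ 2)⁻¹ ≤ 1 + q := inv_le_of_inv_le₀ (by positivity) (by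
    rw [inv_le_iff_one_le_mul₀ (by positivity)]; linarith)
  linarith

/-- With δ = arctan (1/√q) the angle bound says cos (arg x) ≥ -cos δ, and cos² δ = q / (1 + q).
Equality holds on the boundary rays. -/
lemma re_sq_le_of_abs_arg_le {q : ℝ} (hq : 0 < q) {x : ℂ}
    (harg : |x.arg| ≤ Real.pi - Real.arctan (1 / Real.sqrt q)) (hre : x.re < 0) :
    x.re ^ 2 ≤ q * x.im ^ 2 := by
  set δ := Real.arctan (1 / Real.sqrt q) with hδ
  have hδ0 : 0 < δ := Real.arctan_pos.mpr (by positivity)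
  have hcosδ : Real.cos δ ^ 2 = q / (1 + q) := by
    rw [hδ, Real.cos_sq_arctan, div_pow, Real.sq_sqrt hq.le]
    field_simp
    ring
  have hcosδ0 : 0 < Real.cos δ := Real.cos_arctan_pos _
  have h1 : Real.cos (Real.pi - δ) ≤ Real.cos x.arg := by
    rw [← Real.cos_abs x.arg]
    exact Real.cos_le_cos_of_nonneg_of_le_pi (abs_nonneg _) (by linarith) harg
  rw [Real.cos_pi_sub] at h1
  have hn : 0 < ‖x‖ := norm_pos_iff.mpr fun h => by simp [h] at hre
  have hx : ‖x‖ * Real.cos x.arg = x.re := Complex.norm_mul_cos_arg x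
  have hcos : Real.cos x.arg < 0 := by
    by_contra! h
    have : 0 ≤ ‖x‖ * Real.cos x.arg := by positivity
    linarith
  have h2 : Real.cos x.arg ^ 2 ≤ q / (1 + q) := by
    rw [← hcosδ]
    nlinarith
  rw [le_div_iff₀ (by linarith)] at h2
  have h3 : ‖x‖ ^ 2 = x.re ^ 2 + x.im ^ 2 := by
    rw [Complex.sq_norm, Complex.normSq_apply]; ring
  have h4 : x.re ^ 2 = ‖x‖ ^ 2 * Real.cos x.arg ^ 2 := by rw [← hx]; ring
  have h5 : x.re ^ 2 * (1 + q) ≤ ‖x‖ ^ 2 * q := by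
    rw [h4, mul_assoc]
    exact mul_le_mul_of_nonneg_left h2 (by positivity)
  rw [h3] at h5
  linarith

/-! ### The theorem -/

theorem theorem3p2 (k : ℂ) (hk : k.re < 1 / 2) (m : ℝ) :
    (negativeZeros k m = ∅ →
      ∀ x : ℂ, x ≠ 0 → |x.arg| < Real.pi →
        StrictlyCompletelyMonotone (whittakerModulus k m x)) ∧
    ((negativeZeros k m).Nonempty →
      ∃ p : ℝ, IsGreatest (negativeZeros k m) p ∧
        ∃ θ : ℝ, Real.pi / 2 < θ ∧ θ < Real.pi ∧ Real.tan θ = -(1 / Real.sqrt (-p)) ∧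
          ∀ x : ℂ, x ≠ 0 → |x.arg| ≤ θ →
            StrictlyCompletelyMonotone (whittakerModulus k m x)) := by
  have hc : 0 < 2 * (1 / 2 - k).re := by simp; linarith
  have hslit : ∀ x : ℂ, x ≠ 0 → |x.arg| < Real.pi → x ∈ Complex.slitPlane := fun x hx h =>
    Complex.mem_slitPlane_iff_arg.mpr ⟨(abs_lt.mp h).2.ne, hx⟩
  have hlt : ∀ x ∈ Complex.slitPlane, ∀ v : ℝ, 0 < v → 1 - (‖1 + v * x⁻¹‖ ^ 2)⁻¹ < 1 := by
    intro x hx v hv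
    have : 0 < ‖1 + v * x⁻¹‖ := norm_pos_iff.mpr
      (Complex.slitPlane_ne_zero (one_add_mul_mem_slitPlane (inv_mem_slitPlane hx) hv.le))
    have : 0 < (‖1 + v * x⁻¹‖ ^ 2)⁻¹ := by positivity
    linarith
  constructor
  · intro hempty x hx0 harg
    have hx := hslit x hx0 harg
    refine strictlyCompletelyMonotone_whittakerModulus hk m hx fun v hv => ?_
    refine (hypReal_conj_re_pos_of_no_zero _ hc (hlt x hx v hv) fun y _ hy0 hy => ?_).le
    have : y ∈ negativeZeros k m := by rw [negativeZeros_eq hk]; exact ⟨hy0, hy⟩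
    simp [hempty] at this
  · intro hne
    obtain ⟨p, hp⟩ := exists_isGreatest_negativeZeros hk hne
    have hp0 : p < 0 := hp.1.1
    have hq : 0 < -p := by linarith
    have hδ0 : 0 < Real.arctan (1 / Real.sqrt (-p)) := Real.arctan_pos.mpr (by positivity)
    have hδ1 := Real.arctan_lt_pi_div_two (1 / Real.sqrt (-p))
    refine ⟨p, hp, Real.pi - Real.arctan (1 / Real.sqrt (-p)), by linarith, by linarith, ?_, ?_⟩
    · rw [Real.tan_pi_sub, Real.tan_arctan]
    · intro x hx0 harg
      have hx := hslit x hx0 (by linarith)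
      refine strictlyCompletelyMonotone_whittakerModulus hk m hx fun v hv => ?_
      have hn : 0 < Complex.normSq x := Complex.normSq_pos.mpr hx0
      have hge : p ≤ 1 - (‖1 + v * x⁻¹‖ ^ 2)⁻¹ := by
        have := neg_le_one_sub_inv_norm_sq hq (inv_mem_slitPlane hx) (fun h => ?_) hv
        · linarith
        -- Inversion preserves the sign of the real part and the ratio of the squares of real and
        -- imaginary part, so the condition on x⁻¹ is the one on x.
        · rw [Complex.inv_re] at h ⊢
          rw [Complex.inv_im]
          have h' : x.re < 0 := by
            by_contra! h''
            have : 0 ≤ x.re / Complex.normSq x := by positivity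
            linarith
          have := re_sq_le_of_abs_arg_le hq harg h'
          rw [div_pow, div_pow, neg_sq, ← mul_div_assoc]
          exact div_le_div_of_nonneg_right this (by positivity)
      -- On the boundary of the sector the argument can reach p, where the density vanishes;
      -- nonnegativity is all that is required.
      rcases hge.eq_or_lt with h | h
      · have := hp.1
        rw [negativeZeros_eq hk] at this
        rw [← h, this.2, Complex.zero_re]
      · refine (hypReal_conj_re_pos_of_no_zero _ hc (hlt x hx v hv) fun y hy1 hy0 hy => ?_).le
        have : y ∈ negativeZeros k m := by rw [negativeZeros_eq hk]; exact ⟨hy0, hy⟩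
        linarith [hp.2 this]
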